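/- Let $1<\alpha\le 2$. For $\beta>0$ put $n=\lfloor\beta\rfloor+1$ and let $${}_{-\infty}D_x^{\beta}u(x)=\frac{1}{\Gamma(n-\beta)}\frac{d^n}{dx^n}\int_{-\infty}^x (x-s)^{n-\beta-1}u(s)\,ds,\qquad {}_xD_{\infty}^{\beta}u(x)=\frac{(-1)^n}{\Gamma(n-\beta)}\frac{d^n}{dx^n}\int_x^{\infty} (s-x)^{n-\beta-1}u(s)\,ds$$ be the left and right Riemann–Liouville derivatives. For $h>0$ and $q\in\mathbb R$ let $$B^{\alpha}_{h,q}u(x)=\frac1{h^{\alpha}}\sum_{k=0}^{\infty}w_k^{(\alpha)}\,u\bigl(x+(k-q)h\bigr),\qquad w^{(\alpha)}_k=(-1)^k\binom{\alpha}{k}.$$ Let $u\in L^1(\mathbb R)$ (complex-valued) be such that ${}_{-\infty}D_x^{\alpha+2}u$ exists on $\mathbb R$, and such that ${}_{-\infty}D_x^{\alpha+2}u$ and its Fourier transform belong to $L^1(\mathbb R)$. Let $m\ge 2$ be an integer and let $q_1,\dots,q_m,\gamma_1,\dots,\gamma_m$ be real numbers with $$\sum_{j=1}^m\gamma_j=1,\qquad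 \sum_{j=1}^m\gamma_j\Bigl(q_j-\frac{\alpha}{2}\Bigr)=0 .$$ Then ${}_xD_\infty^\alpha u$ exists on $\mathbb R$, and the right WSGD operator satisfies $$\sum_{j=1}^m\gamma_j B^{\alpha}_{h,q_j}u(x)={}_xD_\infty^{\alpha}u(x)+O(h^2)$$ uniformly for $x\in\mathbb R$; that is, there is a constant $C$, independent of $h$ and $x$, such that for every $h>0$ the series converge and the difference of the two sides is at most $Ch^2$ in absolute value, for almost every $x\in\mathbb R$, and for every $x\in\mathbb R$ if $u$ is continuous. -/

import Mathlib

open scoped FourierTransform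

noncomputable section

namespace WSGD

/-- The number `n = ⌊β⌋ + 1` of derivatives in the Riemann-Liouville derivative of order `β`,
i.e. the natural number with `n - 1 ≤ β < n` (for `β ≥ 0`). -/
def rlOrder (β : ℝ) : ℕ := ⌊β⌋₊ + 1

/-- The left fractional integral of order `r > 0` with lower terminal `-∞`:
`1 / Γ(r) ∫_{-∞}^x (x - s)^(r - 1) u(s) ds`. -/
def leftFracIntegral (r : ℝ) (u : ℝ → ℂ) (x : ℝ) : ℂ :=
  (1 / Real.Gamma r) • ∫ s in Set.Iio x, ((x - s) ^ (r - 1)) • u s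

/-- The right fractional integral of order `r > 0` with upper terminal `∞`:
`1 / Γ(r) ∫_x^∞ (s - x)^(r - 1) u(s) ds`. -/
def rightFracIntegral (r : ℝ) (u : ℝ → ℂ) (x : ℝ) : ℂ :=
  (1 / Real.Gamma r) • ∫ s in Set.Ioi x, ((s - x) ^ (r - 1)) • u s

/-- The left Riemann-Liouville derivative of order `β`, with lower terminal `-∞`. -/
def leftRL (β : ℝ) (u : ℝ → ℂ) : ℝ → ℂ :=
  iteratedDeriv (rlOrder β) (leftFracIntegral (rlOrder β - β) u)

/-- The right Riemann-Liouville derivative of order `β`, with upper terminal `∞`. -/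
def rightRL (β : ℝ) (u : ℝ → ℂ) (x : ℝ) : ℂ :=
  (-1) ^ rlOrder β * iteratedDeriv (rlOrder β) (rightFracIntegral (rlOrder β - β) u) x

/-- The left Riemann-Liouville derivative of order `β` of `u` exists at every point: the integrals
converge, and the fractional integral is `n` times differentiable. -/
def LeftRLExists (β : ℝ) (u : ℝ → ℂ) : Prop :=
  (∀ x : ℝ, MeasureTheory.IntegrableOn
    (fun s : ℝ => ((x - s) ^ ((rlOrder β : ℝ) - β - 1)) • u s) (Set.Iio x)) ∧
  ∀ k < rlOrder β,
    Differentiable ℝ (iteratedDeriv k (leftFracIntegral (rlOrder β - β) u))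

/-- The right Riemann-Liouville derivative of order `β` of `u` exists at every point. -/
def RightRLExists (β : ℝ) (u : ℝ → ℂ) : Prop :=
  (∀ x : ℝ, MeasureTheory.IntegrableOn
    (fun s : ℝ => ((s - x) ^ ((rlOrder β : ℝ) - β - 1)) • u s) (Set.Ioi x)) ∧
  ∀ k < rlOrder β,
    Differentiable ℝ (iteratedDeriv k (rightFracIntegral (rlOrder β - β) u))

/-- The normalized Grünwald weights `(-1)^k binom(α, k)`. -/
def grunwaldWeight (α : ℝ) (k : ℕ) : ℝ := (-1) ^ k * Ring.choose α k

/-- The `k`-th term `w_k u(x + (k - q) h)` of the right shifted Grünwald series. -/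
def rightGrunwaldTerm (α h q : ℝ) (u : ℝ → ℂ) (x : ℝ) (k : ℕ) : ℂ :=
  grunwaldWeight α k • u (x + ((k : ℝ) - q) * h)

/-- The right shifted Grünwald difference operator `B^α_{h,q}`. -/
def rightGrunwald (α h q : ℝ) (u : ℝ → ℂ) (x : ℝ) : ℂ :=
  (1 / h ^ α) • ∑' k : ℕ, rightGrunwaldTerm α h q u x k

/-- The right weighted and shifted Grünwald difference (WSGD) operator with weights `γ j` and
shifts `q j`. -/
def rightWSGD {m : ℕ} (α h : ℝ) (q γ : Fin m → ℝ) (u : ℝ → ℂ) (x : ℝ) : ℂ :=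
  ∑ j : Fin m, γ j • rightGrunwald α h (q j) u x

end WSGD

end

noncomputable section

namespace WSGD

open MeasureTheory Filter Topology Set Asymptotics

/-! ### The Grünwald weights -/



/-! Everything becomes a Fourier multiplier. Write `u = 𝓕 g` with `g = 𝓕⁻ u`. On the waves
`e^{-2πiξx}` the operator `-d/dx` is multiplication by `2πiξ`, so the right derivative has symbol
`(2πiξ)^α` (`right_derivative_of_fourier`). With `z = 2πihξ`, the binomial series on the unit circle
gives the shifted Grünwald operator the symbol `h^{-α} e^{qz} (1 - e^{-z})^α`
(`rightGrunwald_fourier`). As `e^{qz} (1 - e^{-z})^α = z^α (1 + (q - α/2) z + O(z²))`, the two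
conditions on the weights leave an error `O(|z|^{α+2})`, valid on the whole imaginary axis because
far from `0` crude bounds suffice (`exists_symbol_bound`). Division by `h^α` leaves `h²` times a
multiple of `∫ |ξ|^{α+2} ‖g‖`, uniformly in `x`.

The left derivative enters only to make this integral finite: its Fourier transform is `(2πiξ)^{α+2}
𝓕 u` (`fourier_iteratedDeriv_leftFracIntegral`). This is tested against Schwartz functions: the
ordinary derivatives and the fractional integral are moved onto the test function, where the right
fractional integral of a Fourier transform is a damped Gamma integral (`rightFracIntegral_fourier`).
Since `g` is also bounded, it is integrable, and Fourier inversion holds almost everywhere. -/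

theorem grunwaldWeight_zero (a : ℝ) : grunwaldWeight a 0 = 1 := by
  simp [grunwaldWeight]

theorem grunwaldWeight_succ (a : ℝ) (k : ℕ) :
    grunwaldWeight a (k + 1) = grunwaldWeight a k * ((k - a) / (k + 1)) := by
  have h : Ring.choose a (k + 1) = Ring.choose a k * ((a - k) / (k + 1)) := by
    have hk : ((k : ℝ) + 1) ≠ 0 := by positivity
    have hf : ((k.factorial : ℝ)) ≠ 0 := by positivity
    rw [Ring.choose_eq_smul, Ring.choose_eq_smul, Nat.factorial_succ, descPochhammer_succ_right,
      Polynomial.smeval_mul]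
    simp [Polynomial.smeval_sub, Polynomial.smeval_natCast, smul_eq_mul]
    field_simp
  rw [grunwaldWeight, grunwaldWeight, h, pow_succ]
  ring

/-- Pascal's rule makes the sum telescope. -/
theorem sum_range_grunwaldWeight (a : ℝ) (n : ℕ) :
    ∑ k ∈ Finset.range (n + 1), grunwaldWeight a k = grunwaldWeight (a - 1) n := by
  induction n with
  | zero => simp [grunwaldWeight_zero]
  | succ n ih =>
    rw [Finset.sum_range_succ, ih]
    have := Ring.choose_succ_succ (a - 1) n
    rw [sub_add_cancel] at this
    simp only [grunwaldWeight, this, pow_succ]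
    ring

theorem abs_grunwaldWeight_le_one {a : ℝ} (h₀ : 0 ≤ a) (h₁ : a ≤ 1) (k : ℕ) :
    |grunwaldWeight a k| ≤ 1 := by
  induction k with
  | zero => simp [grunwaldWeight_zero]
  | succ k ih =>
    rw [grunwaldWeight_succ, abs_mul]
    refine mul_le_one₀ ih (abs_nonneg _) ?_
    rw [abs_div, abs_of_pos (by positivity : (0 : ℝ) < k + 1), div_le_one (by positivity)]
    have : (0 : ℝ) ≤ k := k.cast_nonneg
    rw [abs_le]
    constructor <;> linarith

theorem grunwaldWeight_nonneg {a : ℝ} (h₁ : 1 ≤ a) (h₂ : a ≤ 2) (k : ℕ) :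
    0 ≤ grunwaldWeight a (k + 2) := by
  induction k with
  | zero =>
    rw [grunwaldWeight_succ, grunwaldWeight_succ, grunwaldWeight_zero]
    norm_num
    nlinarith
  | succ k ih =>
    rw [grunwaldWeight_succ]
    refine mul_nonneg ih (div_nonneg ?_ (by positivity))
    push_cast
    have : (0 : ℝ) ≤ k := k.cast_nonneg
    linarith

/-- From index 2 on the weights are nonnegative, so bounded partial sums suffice; these are weights
of order `a - 1 ∈ [0, 1]`, which are at most 1 in absolute value. -/
theorem summable_abs_grunwaldWeight {a : ℝ} (h₁ : 1 ≤ a) (h₂ : a ≤ 2) :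
    Summable fun k => |grunwaldWeight a k| := by
  refine (Summable.abs ?_)
  rw [← summable_nat_add_iff 2]
  refine summable_of_sum_range_le (c := 1 - ∑ k ∈ Finset.range 2, grunwaldWeight a k)
    (grunwaldWeight_nonneg h₁ h₂) fun n => ?_
  have h := sum_range_grunwaldWeight a (n + 1)
  rw [add_assoc, add_comm n, Finset.sum_range_add] at h
  simp only [add_comm (1 + 1)] at h
  have := abs_grunwaldWeight_le_one (a := a - 1) (by linarith) (by linarith) (n + 1)
  linarith [le_abs_self (grunwaldWeight (a - 1) (n + 1))]

/-- The binomial series for the Grünwald weights converges on the open unit disc. -/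
theorem hasSum_grunwaldWeight_of_norm_lt_one (a : ℝ) {z : ℂ} (hz : ‖z‖ < 1) :
    HasSum (fun k => (grunwaldWeight a k : ℂ) * z ^ k) ((1 - z) ^ (a : ℂ)) := by
  have h := (Complex.one_add_cpow_hasFPowerSeriesOnBall_zero (a := (a : ℂ))).hasSum
    (y := -z) (by simpa [Metric.mem_eball, edist_zero_right, ← ofReal_norm] using hz)
  rw [zero_add, ← sub_eq_add_neg] at h
  rw [show (fun k => (grunwaldWeight a k : ℂ) * z ^ k) =
    fun k => binomialSeries ℂ (a : ℂ) k fun _ => -z from ?_]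
  · exact h
  · ext k
    rw [binomialSeries_apply]
    simp [grunwaldWeight, neg_pow z, Complex.ofReal_choose]
    ring

/-- The binomial series converges on the closed unit disc, by Abel summation. -/
theorem hasSum_grunwaldWeight {a : ℝ} (h₁ : 1 ≤ a) (h₂ : a ≤ 2) {z : ℂ} (hz : ‖z‖ ≤ 1) :
    HasSum (fun k => (grunwaldWeight a k : ℂ) * z ^ k) ((1 - z) ^ (a : ℂ)) := by
  have hs := summable_abs_grunwaldWeight h₁ h₂
  have hb : ∀ y : ℂ, ‖y‖ ≤ 1 → ∀ k, ‖(grunwaldWeight a k : ℂ) * y ^ k‖ ≤ |grunwaldWeight a k| := by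
    intro y hy k
    rw [norm_mul, norm_pow, Complex.norm_real, Real.norm_eq_abs]
    exact mul_le_of_le_one_right (abs_nonneg _) (pow_le_one₀ (norm_nonneg _) hy)
  have hsum : Summable fun k => (grunwaldWeight a k : ℂ) * z ^ k := hs.of_norm_bounded (hb z hz)
  refine (hsum.hasSum_iff).2 ?_
  have hcont : Tendsto (fun t : ℝ => (t : ℂ) * z) (𝓝[<] 1) (𝓝 z) := by
    have : Continuous fun t : ℝ => (t : ℂ) * z := by fun_prop
    simpa using (this.tendsto 1).mono_left nhdsWithin_le_nhds
  have hnorm : ∀ᶠ t : ℝ in 𝓝[<] 1, ‖(t : ℂ) * z‖ < 1 := by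
    have h0 : ∀ᶠ t : ℝ in 𝓝[<] 1, 0 < t := nhdsWithin_le_nhds (lt_mem_nhds one_pos)
    filter_upwards [h0, self_mem_nhdsWithin] with t ht ht1
    rw [norm_mul, Complex.norm_real, Real.norm_of_nonneg ht.le]
    exact (mul_le_of_le_one_right ht.le hz).trans_lt ht1
  have hl : Tendsto (fun t : ℝ => ∑' k, (grunwaldWeight a k : ℂ) * ((t : ℂ) * z) ^ k) (𝓝[<] 1)
      (𝓝 (∑' k, (grunwaldWeight a k : ℂ) * z ^ k)) := by
    refine tendsto_tsum_of_dominated_convergence hs (fun k => (hcont.pow k).const_mul _) ?_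
    filter_upwards [hnorm] with t ht k using hb _ ht.le k
  have hr : Tendsto (fun t : ℝ => (1 - (t : ℂ) * z) ^ (a : ℂ)) (𝓝[<] 1)
      (𝓝 ((1 - z) ^ (a : ℂ))) := by
    -- The closed right half-plane meets the branch cut only at `0`, where the power is continuous
    -- because its exponent has positive real part.
    have hre : 0 ≤ (1 - z).re := by
      simpa using (Complex.re_le_norm z).trans hz
    have hc := Complex.continuousAt_cpow_const_of_re_pos (Or.inl hre) (w := a) (by simp; linarith)
    exact hc.tendsto.comp (tendsto_const_nhds.sub hcont)
  refine tendsto_nhds_unique (hl.congr' ?_) hr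
  filter_upwards [hnorm] with t ht using (hasSum_grunwaldWeight_of_norm_lt_one a ht).tsum_eq

/-! ### A complex Gamma integral -/

theorem integrableOn_rpow_mul_exp_neg {s b : ℝ} (hs : 0 < s) (hb : 0 < b) :
    IntegrableOn (fun t : ℝ => t ^ (s - 1) * Real.exp (-b * t)) (Ioi 0) := by
  simpa using integrableOn_rpow_mul_exp_neg_mul_rpow (s := s - 1) (p := 1) (by linarith) one_pos hb

theorem norm_cexp_neg_mul (c : ℂ) (t : ℝ) : ‖Complex.exp (-(c * t))‖ = Real.exp (-c.re * t) := by
  rw [Complex.norm_exp]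
  simp

theorem differentiableAt_integral_rpow_mul_cexp {r : ℝ} (hr : 0 < r) {c : ℂ} (hc : 0 < c.re) :
    DifferentiableAt ℂ
      (fun c : ℂ => ∫ t in Ioi (0 : ℝ), ((t ^ (r - 1) : ℝ) : ℂ) * Complex.exp (-(c * t))) c := by
  have hmeas : ∀ (s : ℝ) (z : ℂ), AEStronglyMeasurable
      (fun t : ℝ => ((t ^ s : ℝ) : ℂ) * Complex.exp (-(z * t))) (volume.restrict (Ioi 0)) := by
    intro s z
    refine Measurable.aestronglyMeasurable ?_
    fun_prop
  refine (hasDerivAt_integral_of_dominated_loc_of_deriv_le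
    (F' := fun z t => ((t ^ (r - 1) : ℝ) : ℂ) * (-t * Complex.exp (-(z * t))))
    -- On the ball of radius `c.re / 2` about `c` the real part stays above `c.re / 2`.
    (bound := fun t => t ^ r * Real.exp (-(c.re / 2) * t))
    (Metric.ball_mem_nhds c (half_pos hc)) (Eventually.of_forall fun z => hmeas _ z) ?_ ?_ ?_ ?_
    ?_).2.differentiableAt
  · refine ((integrableOn_rpow_mul_exp_neg hr hc).mono' (hmeas _ c) ?_)
    refine (ae_restrict_iff' measurableSet_Ioi).2 (ae_of_all _ fun t ht => ?_)
    rw [norm_mul, norm_cexp_neg_mul, Complex.norm_real, Real.norm_of_nonneg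
      (Real.rpow_nonneg (le_of_lt ht) _)]
  · refine Measurable.aestronglyMeasurable ?_
    fun_prop
  · refine (ae_restrict_iff' measurableSet_Ioi).2 (ae_of_all _ fun t ht z hz => ?_)
    have ht : (0 : ℝ) < t := ht
    have hz' : c.re / 2 ≤ z.re := by
      have h1 := (Complex.abs_re_le_norm (z - c)).trans (mem_ball_iff_norm.1 hz).le
      rw [Complex.sub_re, abs_le] at h1
      linarith
    rw [norm_mul, norm_mul, norm_neg, norm_cexp_neg_mul, Complex.norm_real, Complex.norm_real,
      Real.norm_of_nonneg (Real.rpow_nonneg ht.le _), Real.norm_of_nonneg ht.le, ← mul_assoc,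
      Real.rpow_sub_one ht.ne', div_mul_cancel₀ _ ht.ne']
    gcongr
  · have h := integrableOn_rpow_mul_exp_neg (s := r + 1) (by linarith) (half_pos hc)
    rw [add_sub_cancel_right] at h
    exact h
  · refine ae_of_all _ fun t z _ => ?_
    have h1 : HasDerivAt (fun z : ℂ => -(z * t)) (-(t : ℂ)) z := by
      simpa using ((hasDerivAt_id z).mul_const (t : ℂ)).fun_neg
    simpa [mul_comm] using (h1.cexp.const_mul ((t ^ (r - 1) : ℝ) : ℂ))

/-- For real `c` this is the Gamma integral; both sides are analytic on the right half-plane, so the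
identity theorem extends it. -/
theorem integral_rpow_mul_cexp {r : ℝ} (hr : 0 < r) {c : ℂ} (hc : 0 < c.re) :
    ∫ t in Ioi (0 : ℝ), ((t ^ (r - 1) : ℝ) : ℂ) * Complex.exp (-(c * t)) =
      (1 / c) ^ (r : ℂ) * Real.Gamma r := by
  have hU : IsOpen {z : ℂ | 0 < z.re} := isOpen_lt continuous_const Complex.continuous_re
  have hconn : IsPreconnected {z : ℂ | 0 < z.re} :=
    (convex_halfSpace_re_gt 0).isPreconnected
  have h1 : AnalyticOnNhd ℂ
      (fun c : ℂ => ∫ t in Ioi (0 : ℝ), ((t ^ (r - 1) : ℝ) : ℂ) * Complex.exp (-(c * t)))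
      {z : ℂ | 0 < z.re} :=
    DifferentiableOn.analyticOnNhd (fun z hz =>
      (differentiableAt_integral_rpow_mul_cexp hr hz).differentiableWithinAt) hU
  have h2 : AnalyticOnNhd ℂ (fun c : ℂ => (1 / c) ^ (r : ℂ) * Real.Gamma r)
      {z : ℂ | 0 < z.re} := by
    refine DifferentiableOn.analyticOnNhd (fun z (hz : 0 < z.re) => ?_) hU
    have hz0 : z ≠ 0 := by rintro rfl; simp at hz
    refine DifferentiableAt.differentiableWithinAt ?_
    refine DifferentiableAt.mul_const (DifferentiableAt.cpow_const ?_ (Or.inl ?_)) _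
    · exact (differentiableAt_const _).div differentiableAt_id hz0
    · simpa [Complex.inv_re] using div_pos hz (Complex.normSq_pos.2 hz0)
  refine h1.eqOn_of_preconnected_of_frequently_eq h2 hconn (z₀ := 1) (by simp) ?_ hc
  have hev : ∀ x : ℝ, 0 < x → (∫ t in Ioi (0 : ℝ), ((t ^ (r - 1) : ℝ) : ℂ) *
      Complex.exp (-((x : ℂ) * t))) = (1 / (x : ℂ)) ^ (r : ℂ) * Real.Gamma r := by
    intro x hx
    have := Complex.integral_cpow_mul_exp_neg_mul_Ioi (a := r) (by simpa using hr) hx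
    rw [← Complex.Gamma_ofReal, ← this]
    refine setIntegral_congr_fun measurableSet_Ioi fun t ht => ?_
    rw [Complex.ofReal_cpow (le_of_lt ht)]
    simp
  -- Real points different from 1 that accumulate at 1.
  have hlim : Tendsto (fun n : ℕ => (((1 : ℝ) + 1 / ((n : ℝ) + 1) : ℝ) : ℂ)) atTop (𝓝[≠] 1) := by
    refine tendsto_nhdsWithin_iff.2 ⟨?_, Eventually.of_forall fun n => ?_⟩
    · have h := tendsto_one_div_add_atTop_nhds_zero_nat (𝕜 := ℝ)
      have h' := (Complex.continuous_ofReal.tendsto _).comp (h.const_add 1)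
      simpa [Function.comp_def] using h'
    · have : (0 : ℝ) < 1 / ((n : ℝ) + 1) := by positivity
      intro h
      have h' : (1 : ℝ) + 1 / ((n : ℝ) + 1) = 1 := Complex.ofReal_injective (by simpa using h)
      linarith
  exact hlim.frequently (Frequently.of_forall fun n => hev _ (by positivity))

/-! ### The Fourier multiplier of fractional differentiation -/

/-- The Fourier symbol `(2πiξ)^s` of the left fractional derivative of order `s`. -/
def fracSymbol (s ξ : ℝ) : ℂ := (2 * Real.pi * Complex.I * ξ) ^ (s : ℂ)

theorem measurable_fracSymbol (s : ℝ) : Measurable (fracSymbol s) := by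
  unfold fracSymbol
  fun_prop

theorem norm_two_pi_I_mul (ξ : ℝ) : ‖(2 * Real.pi * Complex.I * ξ : ℂ)‖ = 2 * Real.pi * |ξ| := by
  simp [abs_of_pos Real.pi_pos]

theorem norm_fracSymbol (s ξ : ℝ) : ‖fracSymbol s ξ‖ = (2 * Real.pi * |ξ|) ^ s := by
  rw [fracSymbol, Complex.norm_cpow_real, norm_two_pi_I_mul]

theorem two_pi_I_mul_ne_zero {ξ : ℝ} (hξ : ξ ≠ 0) : (2 * Real.pi * Complex.I * ξ : ℂ) ≠ 0 := by
  simp [hξ, Real.pi_ne_zero]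

theorem pow_mul_fracSymbol (n : ℕ) (s : ℝ) {ξ : ℝ} (hξ : ξ ≠ 0) :
    (2 * Real.pi * Complex.I * ξ : ℂ) ^ n * fracSymbol s ξ = fracSymbol (n + s) ξ := by
  rw [fracSymbol, fracSymbol, Complex.ofReal_add, Complex.cpow_add _ _ (two_pi_I_mul_ne_zero hξ)]
  simp

/-! ### Integrability of the fractional kernel against bounded integrable functions -/

/-- The singular part of the fractional kernel. -/
def singularKernel (r : ℝ) : ℝ → ℝ := (Ioc 0 1).indicator fun t => t ^ (r - 1)

theorem integrable_singularKernel {r : ℝ} (hr : 0 < r) : Integrable (singularKernel r) := by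
  rw [singularKernel, integrable_indicator_iff measurableSet_Ioc,
    ← intervalIntegrable_iff_integrableOn_Ioc_of_le zero_le_one]
  exact intervalIntegral.intervalIntegrable_rpow' (by linarith)

theorem rpow_le_singularKernel_add_one {r t : ℝ} (hr : r ≤ 1) (ht : 0 < t) :
    t ^ (r - 1) ≤ singularKernel r t + 1 := by
  by_cases h : t ≤ 1
  · rw [singularKernel, indicator_of_mem (by exact ⟨ht, h⟩)]
    linarith
  · rw [singularKernel, indicator_of_notMem (by simp [h]), zero_add]
    exact Real.rpow_le_one_of_one_le_of_nonpos (not_le.1 h).le (by linarith)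

theorem singularKernel_nonneg (r t : ℝ) : 0 ≤ singularKernel r t :=
  indicator_nonneg (fun _ ht => Real.rpow_nonneg ht.1.le _) _

/-- Near the singularity `f` is bounded and the kernel integrable; farther out the kernel is at most
1 and `f` is integrable. -/
theorem integrableOn_rpow_smul {r : ℝ} (hr₀ : 0 < r) (hr₁ : r ≤ 1) {f : ℝ → ℂ}
    (hf : Integrable f) {M : ℝ} (hM : ∀ᵐ s, ‖f s‖ ≤ M) (x : ℝ) :
    IntegrableOn (fun s : ℝ => ((s - x) ^ (r - 1)) • f s) (Ioi x) := by
  have hd : Integrable fun s => singularKernel r (s - x) * M + ‖f s‖ :=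
    (((integrable_singularKernel hr₀).comp_sub_right x).mul_const M).add hf.norm
  refine hd.integrableOn.mono' ?_ ?_
  · have hm : Measurable fun s : ℝ => (s - x) ^ (r - 1) := by fun_prop
    exact hm.aestronglyMeasurable.smul hf.aestronglyMeasurable.restrict
  · refine (ae_restrict_iff' measurableSet_Ioi).2 (hM.mono fun s hs hsx => ?_)
    have hsx' : 0 < s - x := sub_pos.2 hsx
    have h0 := singularKernel_nonneg r (s - x)
    rw [norm_smul, Real.norm_of_nonneg (Real.rpow_nonneg hsx'.le _)]
    calc (s - x) ^ (r - 1) * ‖f s‖ ≤ (singularKernel r (s - x) + 1) * ‖f s‖ := by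
          gcongr; exact rpow_le_singularKernel_add_one hr₁ hsx'
      _ ≤ _ := by rw [add_mul, one_mul]; gcongr

/-! ### The right fractional integral of a Fourier transform -/

theorem setIntegral_Ioi_eq_comp_add {E : Type*} [NormedAddCommGroup E] [NormedSpace ℝ E]
    (f : ℝ → E) (x : ℝ) : ∫ s in Ioi x, f s = ∫ t in Ioi 0, f (x + t) := by
  have h := (measurePreserving_add_left volume x).setIntegral_preimage_emb
    (measurableEmbedding_addLeft x) f (Ioi x)
  rw [← h]
  simp

theorem integrableOn_Ioi_comp_add {E : Type*} [NormedAddCommGroup E] {f : ℝ → E} {x : ℝ}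
    (hf : IntegrableOn f (Ioi x)) : IntegrableOn (fun t => f (x + t)) (Ioi 0) := by
  have h := ((measurePreserving_add_left volume x).integrableOn_comp_preimage
    (measurableEmbedding_addLeft x) (f := f) (s := Ioi x)).2 hf
  simpa [Function.comp_def] using h

theorem rightFracIntegral_congr_ae (r : ℝ) {f g : ℝ → ℂ} (h : f =ᵐ[volume] g) (x : ℝ) :
    rightFracIntegral r f x = rightFracIntegral r g x := by
  unfold rightFracIntegral
  congr 1
  refine setIntegral_congr_ae measurableSet_Ioi (h.mono fun s hs _ => ?_)
  simp only [hs]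

/-- The damping `e^{-εt}` makes the kernel integrable at infinity, so Fubini applies and the inner
integral is the complex Gamma integral with `c = ε + 2πiξ`. -/
theorem integral_damped_fourier {r : ℝ} (hr : 0 < r) {g : ℝ → ℂ} (hg : Integrable g) (x : ℝ)
    {ε : ℝ} (hε : 0 < ε) :
    ∫ t in Ioi (0 : ℝ), ((t ^ (r - 1) : ℝ) * Complex.exp (-(ε * t)) : ℂ) * 𝓕 g (x + t) =
      ∫ ξ, Complex.exp ((-2 * Real.pi * ξ * x : ℝ) * Complex.I) * g ξ *
        ((1 / (ε + 2 * Real.pi * Complex.I * ξ)) ^ (r : ℂ) * Real.Gamma r) := by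
  have hk : Integrable (fun t : ℝ => ((t ^ (r - 1) : ℝ) * Complex.exp (-(ε * t)) : ℂ))
      (volume.restrict (Ioi 0)) := by
    refine (integrableOn_rpow_mul_exp_neg hr hε).mono'
      (Measurable.aestronglyMeasurable (by fun_prop)) ?_
    refine (ae_restrict_iff' measurableSet_Ioi).2 (ae_of_all _ fun t ht => ?_)
    rw [norm_mul, norm_cexp_neg_mul, Complex.norm_real, Real.norm_of_nonneg
      (Real.rpow_nonneg (le_of_lt ht) _), Complex.ofReal_re]
  have hint : Integrable (Function.uncurry fun (t ξ : ℝ) =>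
      ((t ^ (r - 1) : ℝ) * Complex.exp (-(ε * t)) : ℂ) *
        (Complex.exp ((-2 * Real.pi * ξ * (x + t) : ℝ) * Complex.I) * g ξ))
      ((volume.restrict (Ioi 0)).prod volume) := by
    have h1 := (hk.mul_prod hg).bdd_mul (c := 1)
      (f := fun p : ℝ × ℝ => Complex.exp ((-2 * Real.pi * p.2 * (x + p.1) : ℝ) * Complex.I))
      (Continuous.aestronglyMeasurable (by fun_prop))
      (ae_of_all _ fun p => (Complex.norm_exp_ofReal_mul_I _).le)
    refine h1.congr (ae_of_all _ fun p => ?_)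
    simp only [Function.uncurry]
    ring
  calc _ = ∫ t in Ioi (0 : ℝ), ∫ ξ, ((t ^ (r - 1) : ℝ) * Complex.exp (-(ε * t)) : ℂ) *
        (Complex.exp ((-2 * Real.pi * ξ * (x + t) : ℝ) * Complex.I) * g ξ) := by
        refine integral_congr_ae (ae_of_all _ fun t => ?_)
        simp only [Real.fourier_real_eq_integral_exp_smul, smul_eq_mul]
        rw [integral_const_mul]
    _ = _ := by
        rw [integral_integral_swap hint]
        refine integral_congr_ae (ae_of_all _ fun ξ => ?_)
        simp only
        rw [← integral_rpow_mul_cexp hr (by simpa using hε), ← integral_const_mul]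
        refine integral_congr_ae (ae_of_all _ fun t => ?_)
        simp only
        rw [show (((-2 * Real.pi * ξ * (x + t) : ℝ) : ℂ) * Complex.I) =
          ((-2 * Real.pi * ξ * x : ℝ) : ℂ) * Complex.I + -(2 * Real.pi * Complex.I * ξ * t) by
            push_cast; ring,
          show -((ε + 2 * Real.pi * Complex.I * ξ) * t : ℂ) =
            -(ε * t) + -(2 * Real.pi * Complex.I * ξ * t) by ring,
          Complex.exp_add, Complex.exp_add]
        ring

theorem one_div_two_pi_I_mul_mem_slitPlane {ξ : ℝ} (hξ : ξ ≠ 0) :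
    (1 / (2 * Real.pi * Complex.I * ξ) : ℂ) ∈ Complex.slitPlane := by
  refine Complex.mem_slitPlane_iff.2 (Or.inr ?_)
  rw [one_div, Complex.inv_im]
  refine div_ne_zero ?_ (Complex.normSq_pos.2 (two_pi_I_mul_ne_zero hξ)).ne'
  simp [hξ, Real.pi_ne_zero]

theorem one_div_cpow_eq_fracSymbol (r : ℝ) {ξ : ℝ} (hξ : ξ ≠ 0) :
    (1 / (2 * Real.pi * Complex.I * ξ) : ℂ) ^ (r : ℂ) = fracSymbol (-r) ξ := by
  have h := Complex.slitPlane_arg_ne_pi (one_div_two_pi_I_mul_mem_slitPlane hξ)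
  have h' := Complex.inv_cpow _ (r : ℂ) h
  rw [one_div, inv_inv] at h'
  rw [fracSymbol, Complex.ofReal_neg, Complex.cpow_neg, h', inv_inv, one_div]

/-- Since `|ε + 2πiξ| ≥ 2π|ξ|`, the bound is uniform in `ε`; it dominates the limit `ε → 0`. -/
theorem norm_one_div_cpow_le {r : ℝ} (hr : 0 < r) {ε : ℝ} {ξ : ℝ} (hξ : ξ ≠ 0) :
    ‖(1 / (ε + 2 * Real.pi * Complex.I * ξ) : ℂ) ^ (r : ℂ)‖ ≤ ‖fracSymbol (-r) ξ‖ := by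
  rw [← one_div_cpow_eq_fracSymbol r hξ, Complex.norm_cpow_real, Complex.norm_cpow_real,
    norm_div, norm_div, norm_two_pi_I_mul]
  have h1 := Complex.abs_im_le_norm (ε + 2 * Real.pi * Complex.I * ξ)
  have h2 : (ε + 2 * Real.pi * Complex.I * ξ : ℂ).im = 2 * Real.pi * ξ := by simp
  rw [h2, abs_mul, abs_of_pos Real.two_pi_pos] at h1
  have : 0 < |ξ| := abs_pos.2 hξ
  have := Real.pi_pos
  gcongr

theorem ae_ne_zero : ∀ᵐ ξ : ℝ, ξ ≠ 0 := by
  simp [ae_iff]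

theorem rightFracIntegral_fourier {r : ℝ} (hr : 0 < r) {g : ℝ → ℂ} (hg : Integrable g)
    (hg' : Integrable fun ξ => fracSymbol (-r) ξ * g ξ) {x : ℝ}
    (hint : IntegrableOn (fun s : ℝ => ((s - x) ^ (r - 1)) • 𝓕 g s) (Ioi x)) :
    rightFracIntegral r (𝓕 g) x = 𝓕 (fun ξ => fracSymbol (-r) ξ * g ξ) x := by
  have hint0 := integrableOn_Ioi_comp_add hint
  simp only [add_sub_cancel_left] at hint0
  have hε : Tendsto (fun n : ℕ => 1 / ((n : ℝ) + 1)) atTop (𝓝 0) :=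
    tendsto_one_div_add_atTop_nhds_zero_nat
  -- The damping `ε = 1 / (n + 1)` is removed on both sides by dominated convergence, here with the
  -- undamped integrand as majorant.
  have hl : Tendsto (fun n : ℕ => ∫ t in Ioi (0 : ℝ), ((t ^ (r - 1) : ℝ) *
      Complex.exp (-((1 / ((n : ℝ) + 1) : ℝ) * t)) : ℂ) * 𝓕 g (x + t)) atTop
      (𝓝 (∫ t in Ioi (0 : ℝ), (t ^ (r - 1)) • 𝓕 g (x + t))) := by
    refine tendsto_integral_of_dominated_convergence _ (fun n => ?_) hint0.norm (fun n => ?_) ?_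
    · refine (hint0.aestronglyMeasurable.mul (g := fun t : ℝ =>
        Complex.exp (-((1 / ((n : ℝ) + 1) : ℝ) * t)))
          (Continuous.aestronglyMeasurable (by fun_prop))).congr (ae_of_all _ fun t => ?_)
      simp only [Pi.mul_apply, Complex.real_smul]
      ring
    · refine (ae_restrict_iff' measurableSet_Ioi).2 (ae_of_all _ fun t ht => ?_)
      have ht : 0 < t := ht
      rw [norm_mul, norm_mul, norm_smul, norm_cexp_neg_mul, Complex.norm_real]
      gcongr
      refine mul_le_of_le_one_right (norm_nonneg _) (Real.exp_le_one_iff.2 ?_)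
      rw [Complex.ofReal_re, neg_mul, neg_nonpos]
      positivity
    · refine ae_of_all _ fun t => ?_
      have h1 : Tendsto (fun n : ℕ => Complex.exp (-((1 / ((n : ℝ) + 1) : ℝ) * t))) atTop
          (𝓝 (Complex.exp (-((0 : ℝ) * t)))) :=
        ((Continuous.tendsto (f := fun e : ℝ => Complex.exp (-(e * t))) (by fun_prop) 0).comp hε)
      have h2 := (h1.const_mul ((t ^ (r - 1) : ℝ) : ℂ)).mul_const (𝓕 g (x + t))
      simpa using h2
  have hr' : Tendsto (fun n : ℕ => ∫ ξ, Complex.exp ((-2 * Real.pi * ξ * x : ℝ) * Complex.I) * g ξ *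
        ((1 / ((1 / ((n : ℝ) + 1) : ℝ) + 2 * Real.pi * Complex.I * ξ)) ^ (r : ℂ) * Real.Gamma r))
      atTop (𝓝 (∫ ξ, Complex.exp ((-2 * Real.pi * ξ * x : ℝ) * Complex.I) * g ξ *
        (fracSymbol (-r) ξ * Real.Gamma r))) := by
    refine tendsto_integral_of_dominated_convergence _ (fun n => ?_)
      (hg'.norm.mul_const ‖(Real.Gamma r : ℂ)‖) (fun n => ?_) ?_
    · refine AEStronglyMeasurable.mul (AEStronglyMeasurable.mul
        (Continuous.aestronglyMeasurable (by fun_prop)) hg.aestronglyMeasurable)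
        (Measurable.aestronglyMeasurable (by fun_prop))
    · filter_upwards [ae_ne_zero] with ξ hξ
      simp only [norm_mul, Complex.norm_exp_ofReal_mul_I, one_mul]
      exact (mul_le_mul_of_nonneg_left (mul_le_mul_of_nonneg_right (norm_one_div_cpow_le hr hξ)
        (norm_nonneg _)) (norm_nonneg _)).trans_eq (by ring)
    · filter_upwards [ae_ne_zero] with ξ hξ
      refine Tendsto.const_mul _ (Tendsto.mul_const _ ?_)
      rw [← one_div_cpow_eq_fracSymbol r hξ]
      refine ((continuousAt_cpow_const (one_div_two_pi_I_mul_mem_slitPlane hξ)).tendsto).comp ?_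
      refine Tendsto.div tendsto_const_nhds ?_ (two_pi_I_mul_ne_zero hξ)
      have h1 := ((Complex.continuous_ofReal.tendsto _).comp hε).add_const
        (2 * Real.pi * Complex.I * ξ)
      simpa using h1
  have heq := tendsto_nhds_unique hl (hr'.congr fun n =>
    (integral_damped_fourier hr hg x (by positivity)).symm)
  have hΓ : (Real.Gamma r : ℂ) ≠ 0 := by exact_mod_cast (Real.Gamma_pos_of_pos hr).ne'
  rw [rightFracIntegral, setIntegral_Ioi_eq_comp_add]
  simp only [add_sub_cancel_left]
  rw [heq, Real.fourier_real_eq_integral_exp_smul, Complex.real_smul, ← integral_const_mul]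
  refine integral_congr_ae (ae_of_all _ fun ξ => ?_)
  simp only [smul_eq_mul]
  push_cast
  field_simp

/-! ### Fourier transforms tested against Schwartz functions -/

theorem integral_fourier_mul_eq_flip {f g : ℝ → ℂ} (hf : Integrable f) (hg : Integrable g) :
    ∫ ξ, 𝓕 f ξ * g ξ = ∫ x, f x * 𝓕 g x := by
  have := VectorFourier.integral_fourierIntegral_smul_eq_flip (L := innerₗ ℝ)
    Real.continuous_fourierChar continuous_inner hf hg
  simpa only [flip_innerₗ, smul_eq_mul] using! this

theorem integral_fourierInv_mul_eq_flip {f g : ℝ → ℂ} (hf : Integrable f) (hg : Integrable g) :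
    ∫ ξ, 𝓕⁻ f ξ * g ξ = ∫ x, f x * 𝓕⁻ g x := by
  rw [Real.fourierInv_eq_fourier_comp_neg g, ← integral_fourier_mul_eq_flip hf hg.comp_neg,
    ← integral_neg_eq_self]
  simp [Real.fourierInv_eq_fourier_neg]

theorem continuous_fourier {f : ℝ → ℂ} (hf : Integrable f) : Continuous (𝓕 f) :=
  VectorFourier.fourierIntegral_continuous Real.continuous_fourierChar
    (by exact continuous_inner) hf

theorem norm_fourier_le (f : ℝ → ℂ) (x : ℝ) : ‖𝓕 f x‖ ≤ ∫ y, ‖f y‖ :=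
  VectorFourier.norm_fourierIntegral_le_integral_norm _ _ _ f x

theorem ae_eq_of_integral_mul_schwartz_eq {f₁ f₂ : ℝ → ℂ} (h₁ : LocallyIntegrable f₁)
    (h₂ : LocallyIntegrable f₂)
    (h : ∀ ψ : SchwartzMap ℝ ℂ, ∫ x, f₁ x * ψ x = ∫ x, f₂ x * ψ x) : f₁ =ᵐ[volume] f₂ := by
  refine ae_eq_of_integral_contDiff_smul_eq h₁ h₂ fun g hg hgc => ?_
  have hc : HasCompactSupport fun x => (g x : ℂ) := hgc.comp_left (g := Complex.ofReal) rfl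
  have h' : ∫ x, f₁ x * (g x : ℂ) = ∫ x, f₂ x * (g x : ℂ) :=
    h (hc.toSchwartzMap (Complex.ofRealCLM.contDiff.comp hg))
  simpa [mul_comm] using h'

/-- By duality both transforms move onto a Schwartz function, where inversion is exact; `u` need not
be continuous. -/
theorem fourier_fourierInv_ae_eq {u : ℝ → ℂ} (hu : Integrable u) (hu' : Integrable (𝓕⁻ u)) :
    𝓕 (𝓕⁻ u) =ᵐ[volume] u := by
  refine ae_eq_of_integral_mul_schwartz_eq (continuous_fourier hu').locallyIntegrable
    hu.locallyIntegrable fun ψ => ?_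
  have h : 𝓕⁻ (𝓕 (ψ : ℝ → ℂ)) = ψ := by
    rw [← SchwartzMap.fourier_coe, ← SchwartzMap.fourierInv_coe, FourierTransform.fourierInv_fourier_eq]
  rw [integral_fourier_mul_eq_flip hu' ψ.integrable, ← SchwartzMap.fourier_coe,
    integral_fourierInv_mul_eq_flip hu (SchwartzMap.integrable _), SchwartzMap.fourier_coe, h]

/-! ### Integration by parts against Schwartz functions -/

theorem exists_norm_le_of_integrable_deriv {f : ℝ → ℂ} (hf : Differentiable ℝ f)
    (hf' : Integrable (deriv f)) : ∃ C, ∀ x, ‖f x‖ ≤ C := by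
  refine ⟨‖f 0‖ + ∫ y, ‖deriv f y‖, fun x => ?_⟩
  have h := intervalIntegral.integral_eq_sub_of_hasDerivAt (a := 0) (b := x)
    (fun y _ => (hf y).hasDerivAt) hf'.intervalIntegrable
  have h1 : ‖∫ y in (0 : ℝ)..x, deriv f y‖ ≤ ∫ y, ‖deriv f y‖ :=
    intervalIntegral.norm_integral_le_integral_norm_uIoc.trans
      (setIntegral_le_integral hf'.norm (ae_of_all _ fun _ => norm_nonneg _))
  rw [h] at h1
  calc ‖f x‖ = ‖f 0 + (f x - f 0)‖ := by rw [add_sub_cancel]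
    _ ≤ _ := (norm_add_le _ _).trans (by gcongr)

theorem exists_norm_le_pow_of_deriv {f : ℝ → ℂ} (hf : Differentiable ℝ f) {C : ℝ} {m : ℕ}
    (h : ∀ x, ‖deriv f x‖ ≤ C * (1 + |x| ^ m)) :
    ∀ x, ‖f x‖ ≤ (‖f 0‖ + 2 * C) * (1 + |x| ^ (m + 1)) := by
  intro x
  have hC : 0 ≤ C := by
    have := (norm_nonneg _).trans (h 0)
    exact nonneg_of_mul_nonneg_left this (by positivity)
  have h1 : ‖f x - f 0‖ ≤ C * (1 + |x| ^ m) * ‖x - 0‖ := by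
    refine (convex_closedBall (0 : ℝ) |x|).norm_image_sub_le_of_norm_deriv_le
      (fun y _ => hf y) (fun y hy => (h y).trans ?_) (by simp) (by simp)
    have : |y| ≤ |x| := by simpa using hy
    gcongr
  have h2 : (1 + |x| ^ m) * |x| ≤ 2 * (1 + |x| ^ (m + 1)) := by
    rw [pow_succ]
    rcases le_total |x| 1 with hx | hx
    · have := pow_le_one₀ (n := m) (abs_nonneg x) hx
      have := abs_nonneg x
      have : 0 ≤ |x| ^ m := by positivity
      nlinarith
    · have := one_le_pow₀ (n := m) hx
      nlinarith
  have h3 : (1 : ℝ) ≤ 1 + |x| ^ (m + 1) := by simp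
  rw [sub_zero, Real.norm_eq_abs] at h1
  calc ‖f x‖ = ‖f 0 + (f x - f 0)‖ := by rw [add_sub_cancel]
    _ ≤ ‖f 0‖ + ‖f x - f 0‖ := norm_add_le _ _
    _ ≤ ‖f 0‖ * (1 + |x| ^ (m + 1)) + C * (2 * (1 + |x| ^ (m + 1))) := by
        refine add_le_add (le_mul_of_one_le_right (norm_nonneg _) h3) (h1.trans ?_)
        rw [mul_assoc]
        gcongr
    _ = _ := by ring

/-- An integrable top derivative makes the one below it bounded, and each further integration costs
one power of `|x|`. This gives integrability against Schwartz functions. -/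
theorem exists_polynomial_growth (n : ℕ) {f : ℝ → ℂ}
    (hf : ∀ k < n + 1, Differentiable ℝ (iteratedDeriv k f))
    (hn : Integrable (iteratedDeriv (n + 1) f)) :
    ∃ (C : ℝ) (m : ℕ), ∀ x, ‖f x‖ ≤ C * (1 + |x| ^ m) := by
  induction n generalizing f with
  | zero =>
    obtain ⟨C, hC⟩ := exists_norm_le_of_integrable_deriv (by simpa using hf 0 one_pos)
      (by simpa [iteratedDeriv_one] using hn)
    -- For exponent 0 the factor `1 + |x| ^ 0` equals 2.
    refine ⟨C / 2, 0, fun x => (hC x).trans_eq ?_⟩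
    rw [pow_zero]
    ring
  | succ n ih =>
    obtain ⟨C, m, h⟩ := ih (f := deriv f)
      (fun k hk => by simpa [iteratedDeriv_succ'] using hf (k + 1) (by omega))
      (by simpa [iteratedDeriv_succ'] using hn)
    exact ⟨_, _, exists_norm_le_pow_of_deriv (by simpa using hf 0 (by omega)) h⟩

theorem integrable_mul_schwartz_of_growth {f : ℝ → ℂ} (hf : Continuous f) {C : ℝ} {m : ℕ}
    (h : ∀ x, ‖f x‖ ≤ C * (1 + |x| ^ m)) (φ : SchwartzMap ℝ ℂ) :
    Integrable fun x => f x * φ x := by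
  have h1 : Integrable fun x => C * (‖φ x‖ + ‖x‖ ^ m * ‖φ x‖) :=
    (φ.integrable.norm.add (φ.integrable_pow_mul volume m)).const_mul C
  refine h1.mono' (hf.mul φ.continuous).aestronglyMeasurable (ae_of_all _ fun x => ?_)
  rw [norm_mul]
  refine (mul_le_mul_of_nonneg_right (h x) (norm_nonneg _)).trans_eq ?_
  rw [Real.norm_eq_abs]
  ring

theorem integrable_mul_schwartz {f : ℝ → ℂ} (hf : Integrable f) (φ : SchwartzMap ℝ ℂ) :
    Integrable fun x => f x * φ x := by
  exact hf.mul_bdd (c := ‖φ.toBoundedContinuousFunction‖) φ.continuous.aestronglyMeasurable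
    (ae_of_all _ φ.toBoundedContinuousFunction.norm_coe_le_norm)

theorem integral_iteratedDeriv_mul_schwartz (n : ℕ) {f : ℝ → ℂ}
    (hf : ∀ k < n, Differentiable ℝ (iteratedDeriv k f))
    (hn : Integrable (iteratedDeriv n f)) (φ : SchwartzMap ℝ ℂ) :
    ∫ x, iteratedDeriv n f x * φ x =
      (-1) ^ n * ∫ x, f x * ((SchwartzMap.derivCLM ℂ ℂ)^[n] φ) x := by
  induction n generalizing f with
  | zero => simp
  | succ n ih =>
    have hf0 : Differentiable ℝ f := by simpa using hf 0 (by omega)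
    have hfd : ∀ k < n, Differentiable ℝ (iteratedDeriv k (deriv f)) :=
      fun k hk => by simpa [iteratedDeriv_succ'] using hf (k + 1) (by omega)
    have hnd : Integrable (iteratedDeriv n (deriv f)) := by simpa [iteratedDeriv_succ'] using hn
    set ψ := (SchwartzMap.derivCLM ℂ ℂ)^[n] φ with hψ
    obtain ⟨C, m, hg⟩ := exists_polynomial_growth n hf hn
    have hd : Integrable fun x => deriv f x * ψ x := by
      -- If `deriv f` is already the top derivative, only its integrability is known; otherwise it
      -- grows at most polynomially.
      rcases n with _ | n
      · exact integrable_mul_schwartz (by simpa using hnd) _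
      · obtain ⟨C, m, hg⟩ := exists_polynomial_growth n hfd hnd
        exact integrable_mul_schwartz_of_growth (by simpa using (hfd 0 (by omega)).continuous) hg _
    have hparts := integral_mul_deriv_eq_deriv_mul_of_integrable (u := f) (v := ψ)
      (u' := deriv f) (v' := SchwartzMap.derivCLM ℂ ℂ ψ)
      (fun x _ => (hf0 x).hasDerivAt) (fun x _ => by simpa using ψ.differentiable x |>.hasDerivAt)
      (integrable_mul_schwartz_of_growth hf0.continuous hg _) hd
      (integrable_mul_schwartz_of_growth hf0.continuous hg _)
    rw [iteratedDeriv_succ', ih hfd hnd, Function.iterate_succ_apply', ← hψ, hparts, pow_succ]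
    ring

theorem iterate_derivCLM_eq_iteratedDeriv (n : ℕ) (φ : SchwartzMap ℝ ℂ) :
    ⇑((SchwartzMap.derivCLM ℂ ℂ)^[n] φ) = iteratedDeriv n φ := by
  induction n with
  | zero => simp
  | succ n ih =>
    rw [Function.iterate_succ_apply', iteratedDeriv_succ, ← ih]
    ext x
    simp

theorem integrable_pow_smul_schwartz (ψ : SchwartzMap ℝ ℂ) (k : ℕ) :
    Integrable fun x : ℝ => x ^ k • ψ x := by
  refine (ψ.integrable_pow_mul volume k).mono'
    (Continuous.aestronglyMeasurable (by fun_prop)) (ae_of_all _ fun x => ?_)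
  rw [norm_smul, norm_pow]

/-! ### Duality of the fractional integrals -/

/-- The kernel `t₊^(r - 1)` of the fractional integrals. -/
def fracKernel (r : ℝ) : ℝ → ℝ := (Ioi 0).indicator fun t => t ^ (r - 1)

theorem measurable_fracKernel (r : ℝ) : Measurable (fracKernel r) :=
  Measurable.indicator (by fun_prop) measurableSet_Ioi

theorem fracKernel_nonneg (r t : ℝ) : 0 ≤ fracKernel r t :=
  indicator_nonneg (fun _ ht => Real.rpow_nonneg (le_of_lt ht) _) _

theorem fracKernel_le {r : ℝ} (hr : r ≤ 1) (t : ℝ) : fracKernel r t ≤ singularKernel r t + 1 := by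
  by_cases ht : 0 < t
  · rw [fracKernel, indicator_of_mem (by exact ht)]
    exact rpow_le_singularKernel_add_one hr ht
  · rw [fracKernel, indicator_of_notMem (by exact ht)]
    linarith [singularKernel_nonneg r t]

theorem leftFracIntegral_eq (r : ℝ) (u : ℝ → ℂ) (x : ℝ) :
    leftFracIntegral r u x = (1 / Real.Gamma r) • ∫ s, fracKernel r (x - s) • u s := by
  rw [leftFracIntegral, ← integral_indicator measurableSet_Iio]
  congr 2
  ext s
  by_cases h : s < x <;> simp [fracKernel, indicator, h]

theorem rightFracIntegral_eq (r : ℝ) (u : ℝ → ℂ) (x : ℝ) :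
    rightFracIntegral r u x = (1 / Real.Gamma r) • ∫ s, fracKernel r (s - x) • u s := by
  rw [rightFracIntegral, ← integral_indicator measurableSet_Ioi]
  congr 2
  ext s
  by_cases h : x < s <;> simp [fracKernel, indicator, h]

/-- Fubini: the kernel is at most an integrable function plus 1, so the double integrand is
dominated by a convolution integrand plus a product. -/
theorem integral_leftFracIntegral_mul {r : ℝ} (hr₀ : 0 < r) (hr₁ : r ≤ 1) {u φ : ℝ → ℂ}
    (hu : Integrable u) (hφ : Integrable φ) {M : ℝ} (hM : ∀ x, ‖φ x‖ ≤ M) :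
    ∫ x, leftFracIntegral r u x * φ x = ∫ s, u s * rightFracIntegral r φ s := by
  have hint : Integrable (Function.uncurry fun x s : ℝ => fracKernel r (x - s) • (u s * φ x))
      (volume.prod volume) := by
    have h1 := (hu.norm.convolution_integrand (ContinuousLinearMap.mul ℝ ℝ)
      (integrable_singularKernel hr₀) (μ := volume)).mul_const M
    have h2 := hφ.norm.mul_prod hu.norm
    refine (h1.add h2).mono' ?_ (ae_of_all _ fun p => ?_)
    · have hk : Measurable fun p : ℝ × ℝ => fracKernel r (p.1 - p.2) :=
        (measurable_fracKernel r).comp (by fun_prop)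
      exact hk.aestronglyMeasurable.smul
        (hu.aestronglyMeasurable.comp_snd.mul hφ.aestronglyMeasurable.comp_fst)
    · simp only [Function.uncurry, Pi.add_apply, ContinuousLinearMap.mul_apply']
      have h3 := singularKernel_nonneg r (p.1 - p.2)
      rw [norm_smul, norm_mul, Real.norm_of_nonneg (fracKernel_nonneg _ _)]
      calc fracKernel r (p.1 - p.2) * (‖u p.2‖ * ‖φ p.1‖)
          ≤ (singularKernel r (p.1 - p.2) + 1) * (‖u p.2‖ * ‖φ p.1‖) := by
            gcongr; exact fracKernel_le hr₁ _
        _ = ‖u p.2‖ * singularKernel r (p.1 - p.2) * ‖φ p.1‖ + ‖φ p.1‖ * ‖u p.2‖ := by ring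
        _ ≤ _ := by gcongr; exact hM _
  calc ∫ x, leftFracIntegral r u x * φ x
      = ∫ x, (1 / Real.Gamma r) • ∫ s, fracKernel r (x - s) • (u s * φ x) := by
        congr 1 with x
        rw [leftFracIntegral_eq, smul_mul_assoc, ← integral_mul_const]
        simp only [smul_mul_assoc]
    _ = (1 / Real.Gamma r) • ∫ s, ∫ x, fracKernel r (x - s) • (u s * φ x) := by
        rw [integral_smul, integral_integral_swap hint]
    _ = _ := by
        rw [← integral_smul]
        congr 1 with s
        rw [rightFracIntegral_eq, mul_smul_comm, ← integral_const_mul]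
        simp only [mul_smul_comm]

/-! ### The Fourier transform of the left Riemann-Liouville derivative -/

theorem continuous_fracSymbol {s : ℝ} (hs : 0 < s) : Continuous (fracSymbol s) := by
  refine continuous_iff_continuousAt.2 fun ξ => ?_
  refine (Complex.continuousAt_cpow_const_of_re_pos (Or.inl (by simp))
    (by simpa using hs)).comp (f := fun ξ : ℝ => (2 * Real.pi * Complex.I * ξ : ℂ)) ?_
  fun_prop

/-- The derivatives of `𝓕 ψ` supply a factor `ξ^n`, which absorbs the singularity `|ξ|^{-r}` because
`r ≤ 1 ≤ n`. -/
theorem rightFracIntegral_iterate_deriv_fourier {r : ℝ} (hr₀ : 0 < r) (hr₁ : r ≤ 1) (n : ℕ)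
    (hn : 1 ≤ n) (ψ : SchwartzMap ℝ ℂ) :
    Integrable (fun ξ => fracSymbol (-r) ξ * ((-2 * Real.pi * Complex.I * ξ) ^ n • ψ ξ)) ∧
    rightFracIntegral r ((SchwartzMap.derivCLM ℂ ℂ)^[n] (𝓕 ψ)) =
      𝓕 (fun ξ => fracSymbol (-r) ξ * ((-2 * Real.pi * Complex.I * ξ) ^ n • ψ ξ)) := by
  have hF : ⇑((SchwartzMap.derivCLM ℂ ℂ)^[n] (𝓕 ψ)) =
      𝓕 fun ξ : ℝ => (-2 * Real.pi * Complex.I * ξ) ^ n • ψ ξ := by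
    rw [iterate_derivCLM_eq_iteratedDeriv, SchwartzMap.fourier_coe,
      Real.iteratedDeriv_fourier (N := ⊤) (fun k _ => integrable_pow_smul_schwartz ψ k) le_top]
  have hg : Integrable fun ξ : ℝ => (-2 * Real.pi * Complex.I * ξ : ℂ) ^ n • ψ ξ := by
    refine ((integrable_pow_smul_schwartz ψ n).const_mul ((-2 * Real.pi * Complex.I : ℂ) ^ n)).congr
      (ae_of_all _ fun ξ => ?_)
    simp only [Complex.real_smul, smul_eq_mul, mul_pow, Complex.ofReal_pow]
    ring
  have hg' : Integrable fun ξ => fracSymbol (-r) ξ * ((-2 * Real.pi * Complex.I * ξ) ^ n • ψ ξ) := by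
    refine (ψ.integrable.norm.add hg.norm).mono'
      ((measurable_fracSymbol _).aestronglyMeasurable.mul hg.aestronglyMeasurable) ?_
    filter_upwards [ae_ne_zero] with ξ hξ
    have h0 : 0 < 2 * Real.pi * |ξ| := by have := Real.pi_pos; positivity
    have hnorm : ‖(-2 * Real.pi * Complex.I * ξ : ℂ)‖ = 2 * Real.pi * |ξ| := by
      rw [← norm_two_pi_I_mul, ← norm_neg]
      congr 1
      ring
    simp only [Pi.add_apply]
    rw [norm_mul, norm_smul, norm_fracSymbol, norm_pow, hnorm]
    rcases le_total (2 * Real.pi * |ξ|) 1 with h | h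
    · have : (2 * Real.pi * |ξ|) ^ (-r) * (2 * Real.pi * |ξ|) ^ n ≤ 1 := by
        rw [← Real.rpow_natCast, ← Real.rpow_add h0]
        refine Real.rpow_le_one h0.le h ?_
        have : (1 : ℝ) ≤ n := by exact_mod_cast hn
        linarith
      rw [← mul_assoc]
      exact (mul_le_of_le_one_left (norm_nonneg _) this).trans
        (le_add_of_nonneg_right (by positivity))
    · exact (mul_le_of_le_one_left (by positivity)
        (Real.rpow_le_one_of_one_le_of_nonpos h (by linarith))).trans
        (le_add_of_nonneg_left (by positivity))
  refine ⟨hg', ?_⟩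
  ext x
  have hint := integrableOn_rpow_smul hr₀ hr₁
    (SchwartzMap.integrable ((SchwartzMap.derivCLM ℂ ℂ)^[n] (𝓕 ψ)))
    (ae_of_all _ (by rw [hF]; exact norm_fourier_le _)) x
  rw [hF] at hint ⊢
  exact rightFracIntegral_fourier hr₀ hg hg' hint

theorem fourier_iteratedDeriv_leftFracIntegral {r : ℝ} (hr₀ : 0 < r) (hr₁ : r ≤ 1) {n : ℕ}
    (hn : 2 ≤ n) {u : ℝ → ℂ} (hu : Integrable u)
    (hd : ∀ k < n, Differentiable ℝ (iteratedDeriv k (leftFracIntegral r u)))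
    (hi : Integrable (iteratedDeriv n (leftFracIntegral r u))) :
    𝓕 (iteratedDeriv n (leftFracIntegral r u)) =ᵐ[volume]
      fun ξ => fracSymbol (n - r) ξ * 𝓕 u ξ := by
  have hn' : (2 : ℝ) ≤ n := by exact_mod_cast hn
  refine ae_eq_of_integral_mul_schwartz_eq (continuous_fourier hi).locallyIntegrable
    ((continuous_fracSymbol (by linarith)).mul (continuous_fourier hu)).locallyIntegrable
    fun ψ => ?_
  obtain ⟨hint, hF⟩ := rightFracIntegral_iterate_deriv_fourier hr₀ hr₁ n (by omega) ψ
  have hM := ((SchwartzMap.derivCLM ℂ ℂ)^[n] (𝓕 ψ)).toBoundedContinuousFunction.norm_coe_le_norm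
  rw [integral_fourier_mul_eq_flip hi ψ.integrable, ← SchwartzMap.fourier_coe,
    integral_iteratedDeriv_mul_schwartz n hd hi, integral_leftFracIntegral_mul hr₀ hr₁ hu
      (SchwartzMap.integrable _) hM, hF,
    ← integral_fourier_mul_eq_flip hu hint, ← integral_const_mul]
  refine integral_congr_ae ?_
  filter_upwards [ae_ne_zero] with ξ hξ
  -- The sign `(-1)^n` from integration by parts cancels the one in `(-2πiξ)^n`.
  rw [sub_eq_add_neg, ← pow_mul_fracSymbol n (-r) hξ, smul_eq_mul,
    show (-2 * Real.pi * Complex.I * ξ : ℂ) = (-1) * (2 * Real.pi * Complex.I * ξ) by ring,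
    mul_pow (-1)]
  have : ((-1 : ℂ) ^ n) * (-1) ^ n = 1 := by rw [← mul_pow]; simp
  linear_combination (𝓕 u ξ * fracSymbol (-r) ξ * (2 * Real.pi * Complex.I * ξ) ^ n * ψ ξ) * this

/-! ### The symbol of the weighted and shifted Grünwald operator -/

/-- The arguments are at most, respectively less than, `π/2` in absolute value, so their sum does
not leave the principal branch. -/
theorem mul_cpow_of_re_nonneg_of_re_pos {a b : ℂ} (ha : 0 ≤ a.re) (hb : 0 < b.re) {s : ℂ}
    (hs : s ≠ 0) : (a * b) ^ s = a ^ s * b ^ s := by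
  rcases eq_or_ne a 0 with rfl | ha0
  · simp [Complex.zero_cpow hs]
  have hb0 : b ≠ 0 := by rintro rfl; simp at hb
  have h1 := abs_le.1 (Complex.abs_arg_le_pi_div_two_iff.2 ha)
  have h2 := abs_lt.1 (Complex.abs_arg_lt_pi_div_two_iff.2 (Or.inl hb))
  rw [Complex.cpow_def_of_ne_zero (mul_ne_zero ha0 hb0), Complex.cpow_def_of_ne_zero ha0,
    Complex.cpow_def_of_ne_zero hb0, (Complex.log_mul_eq_add_log_iff ha0 hb0).2 ⟨by linarith, by linarith⟩, add_mul,
    Complex.exp_add]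

/-- The symbol `e^{qz} (1 - e^{-z})^α` of the shifted Grünwald difference. -/
def grunwaldSymbol (α q : ℝ) (z : ℂ) : ℂ :=
  Complex.exp (q * z) * (1 - Complex.exp (-z)) ^ (α : ℂ)

theorem isBigO_expQuotient : (fun z : ℂ => (1 - Complex.exp (-z)) / z - 1 + z / 2) =O[𝓝[≠] 0]
    fun z => z ^ 2 := by
  refine IsBigO.of_bound 1 ?_
  have h : ∀ᶠ z : ℂ in 𝓝[≠] 0, ‖z‖ < 1 :=
    nhdsWithin_le_nhds (by
      filter_upwards [Metric.ball_mem_nhds (0 : ℂ) one_pos] with z hz using by simpa using hz)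
  filter_upwards [h, self_mem_nhdsWithin] with z hz hz0
  have hz0 : z ≠ 0 := hz0
  have h3 := Complex.exp_bound (x := -z) (by simpa using hz.le) (n := 3) (by norm_num)
  have h4 : (1 - Complex.exp (-z)) / z - 1 + z / 2 =
      -(Complex.exp (-z) - ∑ m ∈ Finset.range 3, (-z) ^ m / m.factorial) / z := by
    simp only [Finset.sum_range_succ, Finset.sum_range_zero, Nat.factorial]
    field_simp
    push_cast
    ring
  rw [h4, norm_div, norm_neg, div_le_iff₀ (norm_pos_iff.2 hz0), norm_pow]
  refine h3.trans ?_
  rw [norm_neg]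
  norm_num [Nat.factorial]
  nlinarith [pow_pos (norm_pos_iff.2 hz0) 3]

theorem isBigO_one_add_cpow (a : ℂ) : (fun w : ℂ => (1 + w) ^ a - 1 - a * w) =O[𝓝 0]
    fun w => w ^ 2 := by
  have h := (Complex.one_add_cpow_hasFPowerSeriesAt_zero (a := a)).isBigO_sub_partialSum_pow 2
  refine (h.congr_left fun w => ?_).trans (isBigO_of_le _ fun w => by simp)
  rw [FormalMultilinearSeries.partialSum, Finset.sum_range_succ, Finset.sum_range_one,
    binomialSeries_apply, binomialSeries_apply]
  simp
  ring

theorem isBigO_sum_exp {m : ℕ} (q γ : Fin m → ℝ) :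
    (fun z : ℂ => ∑ j, (γ j : ℂ) * Complex.exp (q j * z) - ∑ j, (γ j : ℂ) -
      (∑ j, (γ j : ℂ) * q j) * z) =O[𝓝 0] fun z => z ^ 2 := by
  have h : ∀ c : ℂ, (fun z : ℂ => Complex.exp (c * z) - 1 - c * z) =O[𝓝 0] fun z => z ^ 2 := by
    intro c
    have ht : Tendsto (fun z : ℂ => c * z) (𝓝 0) (𝓝 0) := by
      have : Continuous fun z : ℂ => c * z := by fun_prop
      simpa using this.tendsto 0
    have h0 : (fun x : ℂ => Complex.exp x - 1 - x) =O[𝓝 0] fun x => x ^ 2 := by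
      refine IsBigO.of_bound 1 ?_
      filter_upwards [Metric.ball_mem_nhds (0 : ℂ) one_pos] with x hx
      rw [norm_pow, one_mul]
      exact Complex.norm_exp_sub_one_sub_id_le (by simpa using (mem_ball_zero_iff.1 hx).le)
    refine (h0.comp_tendsto ht).trans ?_
    simp only [Function.comp_def, mul_pow]
    exact isBigO_const_mul_self _ _ _
  have h2 : (fun z : ℂ => ∑ j, (γ j : ℂ) * (Complex.exp (q j * z) - 1 - q j * z)) =O[𝓝 0]
      fun z => z ^ 2 := IsBigO.fun_sum fun j _ => (h _).const_mul_left _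
  refine h2.congr_left fun z => ?_
  rw [Finset.sum_mul, ← Finset.sum_sub_distrib, ← Finset.sum_sub_distrib]
  exact Finset.sum_congr rfl fun j _ => by ring

/-- The conditions on the weights give `1 + (α/2) z + O(z²)` for the exponential sum, and the power
is `1 - (α/2) z + O(z²)`: the linear terms cancel. -/
theorem isBigO_normalizedSymbol (α : ℝ) {m : ℕ} (q γ : Fin m → ℝ)
    (hγ : ∑ j, γ j = 1) (hγq : ∑ j, γ j * (q j - α / 2) = 0) :
    (fun z : ℂ => (∑ j, (γ j : ℂ) * Complex.exp (q j * z)) *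
      ((1 - Complex.exp (-z)) / z) ^ (α : ℂ) - 1) =O[𝓝[≠] 0] fun z => z ^ 2 := by
  have hq : ∑ j, (γ j : ℂ) * q j = α / 2 := by
    have h1 : ∑ j, γ j * q j = α / 2 := by
      simp only [mul_sub, Finset.sum_sub_distrib, ← Finset.sum_mul, hγ] at hγq
      linarith
    exact_mod_cast congrArg (Complex.ofReal) h1
  have hγ' : ∑ j, (γ j : ℂ) = 1 := by exact_mod_cast congrArg (Complex.ofReal) hγ
  have hS := (isBigO_sum_exp q γ).mono (nhdsWithin_le_nhds (s := {0}ᶜ))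
  rw [hq, hγ'] at hS
  have hid : Tendsto (fun z : ℂ => z) (𝓝[≠] 0) (𝓝 0) := nhdsWithin_le_nhds
  have hsq : (fun z : ℂ => z ^ 2) =O[𝓝[≠] 0] fun z => z :=
    (IsLittleO.isBigO (isLittleO_pow_id one_lt_two)).mono nhdsWithin_le_nhds
  have hw : (fun z : ℂ => (1 - Complex.exp (-z)) / z - 1) =O[𝓝[≠] 0] fun z => z := by
    refine ((isBigO_expQuotient.trans hsq).sub
      (isBigO_const_mul_self (1 / 2 : ℂ) (fun z : ℂ => z) _)).congr_left fun z => ?_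
    ring
  have hw0 : Tendsto (fun z : ℂ => (1 - Complex.exp (-z)) / z - 1) (𝓝[≠] 0) (𝓝 0) :=
    hw.trans_tendsto hid
  have hP : (fun z : ℂ => ((1 - Complex.exp (-z)) / z) ^ (α : ℂ) - 1 + α / 2 * z) =O[𝓝[≠] 0]
      fun z => z ^ 2 := by
    have h1 := ((isBigO_one_add_cpow α).comp_tendsto hw0).trans (hw.pow 2)
    refine (h1.add (isBigO_expQuotient.const_mul_left (α : ℂ))).congr_left fun z => ?_
    simp only [Function.comp_def, add_sub_cancel]
    ring
  have hP1 : (fun z : ℂ => ((1 - Complex.exp (-z)) / z) ^ (α : ℂ)) =O[𝓝[≠] 0]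
      fun _ => (1 : ℂ) := by
    have h1 : (fun z : ℂ => z ^ 2) =O[𝓝[≠] 0] fun _ => (1 : ℂ) :=
      hsq.trans (hid.isBigO_one ℂ)
    have h2 : (fun z : ℂ => 1 - α / 2 * z) =O[𝓝[≠] 0] fun _ => (1 : ℂ) :=
      (isBigO_refl _ _).sub ((hid.isBigO_one ℂ).const_mul_left _)
    refine ((hP.trans h1).add h2).congr_left fun z => ?_
    ring
  have hL : (fun z : ℂ => 1 + α / 2 * z) =O[𝓝[≠] 0] fun _ => (1 : ℂ) :=
    (isBigO_refl _ _).add ((hid.isBigO_one ℂ).const_mul_left _)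
  have h1 := (hS.mul hP1).congr_right (g₂ := fun z => z ^ 2) fun z => mul_one _
  have h2 := (hL.mul hP).congr_right (g₂ := fun z => z ^ 2) fun z => one_mul _
  -- The subtracted term comes from `(1 + (α/2) z)(1 - (α/2) z) = 1 - (α/2)² z²`.
  refine ((h1.add h2).sub (isBigO_const_mul_self ((α / 2 : ℂ) ^ 2) (fun z : ℂ => z ^ 2)
    _)).congr_left fun z => ?_
  ring

theorem norm_grunwaldSymbol_le {α : ℝ} (hα : 0 ≤ α) (q y : ℝ) :
    ‖grunwaldSymbol α q (Complex.I * y)‖ ≤ 2 ^ α := by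
  have h1 : ‖Complex.exp (q * (Complex.I * y))‖ = 1 := by
    rw [show (q * (Complex.I * y) : ℂ) = ((q * y : ℝ) : ℂ) * Complex.I by push_cast; ring,
      Complex.norm_exp_ofReal_mul_I]
  have h2 : ‖Complex.exp (-(Complex.I * y))‖ = 1 := by
    rw [show (-(Complex.I * y) : ℂ) = ((-y : ℝ) : ℂ) * Complex.I by push_cast; ring,
      Complex.norm_exp_ofReal_mul_I]
  rw [grunwaldSymbol, norm_mul, h1, one_mul, Complex.norm_cpow_real]
  refine Real.rpow_le_rpow (norm_nonneg _) ((norm_sub_le _ _).trans ?_) hα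
  rw [h2, norm_one]
  norm_num

theorem exists_symbol_bound {α : ℝ} (hα : 0 < α) {m : ℕ} (q γ : Fin m → ℝ)
    (hγ : ∑ j, γ j = 1) (hγq : ∑ j, γ j * (q j - α / 2) = 0) :
    ∃ C, 0 ≤ C ∧ ∀ y : ℝ, ‖∑ j, (γ j : ℂ) * grunwaldSymbol α (q j) (Complex.I * y) -
      (Complex.I * y) ^ (α : ℂ)‖ ≤ C * |y| ^ (α + 2) := by
  have hα' : (α : ℂ) ≠ 0 := by exact_mod_cast hα.ne'
  obtain ⟨C, hC0, hC⟩ := (isBigO_normalizedSymbol α q γ hγ hγq).exists_pos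
  -- Positivity of this real part permits factoring `z^α` out of `(1 - e^{-z})^α` on the imaginary
  -- axis.
  have hre : ∀ᶠ z : ℂ in 𝓝[≠] 0, 0 < ((1 - Complex.exp (-z)) / z).re := by
    have ht : Tendsto (fun z : ℂ => ((1 - Complex.exp (-z)) / z)) (𝓝[≠] 0) (𝓝 1) := by
      have h1 := isBigO_expQuotient.trans_tendsto (g'' := fun z : ℂ => z ^ 2) (by
        have : Continuous fun z : ℂ => z ^ 2 := by fun_prop
        simpa using (this.tendsto 0).mono_left nhdsWithin_le_nhds)
      have h2 : Tendsto (fun z : ℂ => 1 - z / 2) (𝓝[≠] 0) (𝓝 1) := by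
        have : Continuous fun z : ℂ => 1 - z / 2 := by fun_prop
        simpa using (this.tendsto 0).mono_left nhdsWithin_le_nhds
      have h3 := h1.add h2
      rw [zero_add] at h3
      refine h3.congr fun z => ?_
      ring
    have := (Complex.continuous_re.tendsto 1).comp ht
    exact this.eventually (lt_mem_nhds (by simp))
  have hev := hC.bound.and hre
  rw [eventually_nhdsWithin_iff, Metric.eventually_nhds_iff] at hev
  obtain ⟨δ, hδ, hev⟩ := hev
  set D := ∑ j, |γ j| * 2 ^ α with hD
  have hD0 : 0 ≤ D := Finset.sum_nonneg fun j _ => by positivity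
  -- `C` serves `|y| < δ`. For `|y| ≥ δ` the Grünwald part is at most `D` and the other is `|y|^α`;
  -- multiplying by powers of `|y|/δ ≥ 1` produces the last two terms.
  refine ⟨C + (D * δ ^ (-(α + 2)) + δ ^ (-(2 : ℝ))), by positivity, fun y => ?_⟩
  have hyn : ‖Complex.I * y‖ = |y| := by simp
  rcases eq_or_ne y 0 with rfl | hy
  · simp [grunwaldSymbol, Complex.zero_cpow hα']
    positivity
  have hy' : 0 < |y| := abs_pos.2 hy
  rcases lt_or_ge |y| δ with hlt | hge
  · have hz0 : (Complex.I * y : ℂ) ≠ 0 := by simp [hy]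
    obtain ⟨h1, h2⟩ := hev (y := Complex.I * y) (by simpa using hlt) hz0
    have h3 : (1 - Complex.exp (-(Complex.I * y))) ^ (α : ℂ) = (Complex.I * y) ^ (α : ℂ) *
        ((1 - Complex.exp (-(Complex.I * y))) / (Complex.I * y)) ^ (α : ℂ) := by
      rw [← mul_cpow_of_re_nonneg_of_re_pos (by simp) h2 hα', mul_div_cancel₀ _ hz0]
    have h4 : ∑ j, (γ j : ℂ) * grunwaldSymbol α (q j) (Complex.I * y) -
        (Complex.I * y) ^ (α : ℂ) = (Complex.I * y) ^ (α : ℂ) *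
        ((∑ j, (γ j : ℂ) * Complex.exp (q j * (Complex.I * y))) *
          ((1 - Complex.exp (-(Complex.I * y))) / (Complex.I * y)) ^ (α : ℂ) - 1) := by
      simp only [grunwaldSymbol, ← mul_assoc, ← Finset.sum_mul]
      rw [h3]
      ring
    rw [h4, norm_mul, Complex.norm_cpow_real, hyn]
    rw [norm_pow, hyn] at h1
    calc |y| ^ α * _ ≤ |y| ^ α * (C * |y| ^ 2) := by gcongr
      _ = C * |y| ^ (α + 2) := by rw [Real.rpow_add hy']; norm_num; ring
      _ ≤ _ := by
        gcongr
        exact le_add_of_nonneg_right (by positivity)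
  · have h1 : ‖∑ j, (γ j : ℂ) * grunwaldSymbol α (q j) (Complex.I * y)‖ ≤ D := by
      refine (norm_sum_le _ _).trans (Finset.sum_le_sum fun j _ => ?_)
      rw [norm_mul, Complex.norm_real, Real.norm_eq_abs]
      gcongr
      exact norm_grunwaldSymbol_le hα.le _ _
    have h2 : 1 ≤ δ ^ (-(α + 2)) * |y| ^ (α + 2) := by
      rw [Real.rpow_neg hδ.le, ← Real.inv_rpow hδ.le, ← Real.mul_rpow (by positivity) hy'.le]
      refine Real.one_le_rpow ?_ (by linarith)
      rw [← div_eq_inv_mul]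
      exact (one_le_div hδ).2 hge
    have h3 : 1 ≤ δ ^ (-(2 : ℝ)) * |y| ^ (2 : ℝ) := by
      rw [Real.rpow_neg hδ.le, ← Real.inv_rpow hδ.le, ← Real.mul_rpow (by positivity) hy'.le]
      refine Real.one_le_rpow ?_ (by norm_num)
      rw [← div_eq_inv_mul]
      exact (one_le_div hδ).2 hge
    have h4 : |y| ^ α ≤ δ ^ (-(2 : ℝ)) * |y| ^ (α + 2) := by
      rw [Real.rpow_add hy']
      calc |y| ^ α ≤ |y| ^ α * (δ ^ (-(2 : ℝ)) * |y| ^ (2 : ℝ)) :=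
            le_mul_of_one_le_right (by positivity) h3
        _ = _ := by ring
    have h5 : D ≤ D * δ ^ (-(α + 2)) * |y| ^ (α + 2) := by
      rw [mul_assoc]
      exact le_mul_of_one_le_right hD0 h2
    have h6 : 0 ≤ C * |y| ^ (α + 2) := by positivity
    refine (norm_sub_le _ _).trans ?_
    rw [Complex.norm_cpow_real, hyn, add_mul, add_mul]
    linarith

/-! ### Fourier data with an integrable power weight -/

/-- For `|ξ| ≤ 1` boundedness of `g` and `s > -1` suffice; for `|ξ| ≥ 1` the larger weight
dominates. -/
theorem integrable_rpow_abs_mul {g : ℝ → ℂ} (hg : Continuous g) {M : ℝ} (hM : ∀ ξ, ‖g ξ‖ ≤ M)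
    {s₀ : ℝ} (h₀ : Integrable fun ξ => |ξ| ^ s₀ * ‖g ξ‖) {s : ℝ} (hs : -1 < s) (hs₀ : s ≤ s₀) :
    Integrable fun ξ => |ξ| ^ s * ‖g ξ‖ := by
  have hk := integrable_singularKernel (r := s + 1) (by linarith)
  refine (((hk.add hk.comp_neg).mul_const M).add h₀).mono'
    (Measurable.aestronglyMeasurable (by fun_prop)) ?_
  filter_upwards [ae_ne_zero] with ξ hξ
  have hξ' : 0 < |ξ| := abs_pos.2 hξ
  have hM0 : 0 ≤ M := (norm_nonneg _).trans (hM 0)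
  have h1 := singularKernel_nonneg (s + 1) ξ
  have h2 := singularKernel_nonneg (s + 1) (-ξ)
  rw [Real.norm_of_nonneg (by positivity)]
  simp only [Pi.add_apply]
  rcases le_total |ξ| 1 with h | h
  · have h3 : |ξ| ^ s ≤ singularKernel (s + 1) ξ + singularKernel (s + 1) (-ξ) := by
      have h4 : singularKernel (s + 1) |ξ| = |ξ| ^ s := by
        rw [singularKernel, indicator_of_mem (by exact ⟨hξ', h⟩), add_sub_cancel_right]
      rw [← h4]
      rcases abs_choice ξ with h5 | h5 <;> rw [h5] <;> linarith
    calc |ξ| ^ s * ‖g ξ‖ ≤ (singularKernel (s + 1) ξ + singularKernel (s + 1) (-ξ)) * M := by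
          gcongr; exact hM ξ
      _ ≤ _ := le_add_of_nonneg_right (by positivity)
  · calc |ξ| ^ s * ‖g ξ‖ ≤ |ξ| ^ s₀ * ‖g ξ‖ := by gcongr
      _ ≤ _ := le_add_of_nonneg_left (by positivity)

theorem integrable_pow_smul_fracSymbol_mul {g : ℝ → ℂ} (hg : Continuous g) (k : ℕ) (s : ℝ)
    (h : Integrable fun ξ => |ξ| ^ (k + s) * ‖g ξ‖) :
    Integrable fun ξ : ℝ => ξ ^ k • (fracSymbol s ξ * g ξ) := by
  refine (h.const_mul ((2 * Real.pi) ^ s)).mono'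
    (Measurable.aestronglyMeasurable ?_) ?_
  · exact (measurable_id.pow_const k).smul ((measurable_fracSymbol s).mul hg.measurable)
  · filter_upwards [ae_ne_zero] with ξ hξ
    have hξ' : 0 < |ξ| := abs_pos.2 hξ
    rw [norm_smul, norm_mul, norm_fracSymbol, norm_pow, Real.norm_eq_abs,
      Real.mul_rpow Real.two_pi_pos.le hξ'.le, Real.rpow_add hξ', Real.rpow_natCast]
    exact le_of_eq (by ring)

theorem integrable_fracSymbol_mul {g : ℝ → ℂ} (hg : Continuous g) (s : ℝ)
    (h : Integrable fun ξ => |ξ| ^ s * ‖g ξ‖) : Integrable fun ξ : ℝ => fracSymbol s ξ * g ξ := by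
  simpa using integrable_pow_smul_fracSymbol_mul hg 0 s (by simpa using h)

theorem integrable_rpow_abs_mul_of_fracSymbol {g : ℝ → ℂ} {s : ℝ}
    (h : Integrable fun ξ => fracSymbol s ξ * g ξ) : Integrable fun ξ => |ξ| ^ s * ‖g ξ‖ := by
  have hpi : (0 : ℝ) < (2 * Real.pi) ^ s := Real.rpow_pos_of_pos Real.two_pi_pos _
  refine (h.norm.const_mul ((2 * Real.pi) ^ s)⁻¹).congr (ae_of_all _ fun ξ => ?_)
  simp only
  rw [norm_mul, norm_fracSymbol, Real.mul_rpow Real.two_pi_pos.le (abs_nonneg _)]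
  field_simp

/-! ### The right Riemann-Liouville derivative of a Fourier transform -/

theorem differentiable_iteratedDeriv_fourier {f : ℝ → ℂ} {N : ℕ}
    (hf : ∀ k ≤ N, Integrable fun ξ : ℝ => ξ ^ k • f ξ) {k : ℕ} (hk : k < N) :
    Differentiable ℝ (iteratedDeriv k (𝓕 f)) := by
  have h : ContDiff ℝ ((N : ℕ∞) : WithTop ℕ∞) (𝓕 f) := by
    refine Real.contDiff_fourier fun n hn => ?_
    have := (hf n (by exact_mod_cast hn)).norm
    simpa only [norm_smul, norm_pow] using this
  exact h.differentiable_iteratedDeriv k (by exact_mod_cast hk)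

theorem iteratedDeriv_fourier_apply {f : ℝ → ℂ} {N : ℕ}
    (hf : ∀ k ≤ N, Integrable fun ξ : ℝ => ξ ^ k • f ξ) :
    iteratedDeriv N (𝓕 f) = 𝓕 fun ξ : ℝ => (-2 * Real.pi * Complex.I * ξ) ^ N • f ξ :=
  Real.iteratedDeriv_fourier (N := N) (fun k hk => hf k (by exact_mod_cast hk)) le_rfl

/-- The sign exponent `n` is kept apart from `N` because for `α = 2` one of the three derivatives is
spent before the Fourier transform is differentiated. -/
theorem neg_one_pow_mul_fourier (n N : ℕ) (f : ℝ → ℂ) (s : ℝ) (g : ℝ → ℂ)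
    (h : ∀ ξ ≠ 0, (-1) ^ n * ((-2 * Real.pi * Complex.I * ξ) ^ N * f ξ) = fracSymbol s ξ * g ξ)
    (x : ℝ) :
    (-1) ^ n * 𝓕 (fun ξ : ℝ => (-2 * Real.pi * Complex.I * ξ) ^ N • f ξ) x =
      𝓕 (fun ξ => fracSymbol s ξ * g ξ) x := by
  rw [Real.fourier_real_eq_integral_exp_smul, Real.fourier_real_eq_integral_exp_smul,
    ← integral_const_mul]
  refine integral_congr_ae ?_
  filter_upwards [ae_ne_zero] with ξ hξ
  rw [← h ξ hξ]
  simp only [smul_eq_mul]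
  ring

theorem rlOrder_of_lt_two {α : ℝ} (h₁ : 1 < α) (h₂ : α < 2) : rlOrder α = 2 := by
  have : ⌊α⌋₊ = 1 :=
    (Nat.floor_eq_iff (by linarith)).2 ⟨by simpa using h₁.le, by norm_num; exact h₂⟩
  rw [rlOrder, this]

theorem rlOrder_two : rlOrder 2 = 3 := by
  simp [rlOrder]

theorem rlOrder_add_two {α : ℝ} (h : 0 ≤ α) : rlOrder (α + 2) = rlOrder α + 2 := by
  rw [rlOrder, rlOrder, show α + 2 = α + (2 : ℕ) by simp, Nat.floor_add_natCast h]

theorem rlOrder_sub_pos {α : ℝ} : 0 < (rlOrder α : ℝ) - α := by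
  have := Nat.lt_floor_add_one α
  rw [rlOrder]
  push_cast
  linarith

theorem rlOrder_sub_le_one {α : ℝ} (h : 0 ≤ α) : (rlOrder α : ℝ) - α ≤ 1 := by
  have := Nat.floor_le h
  rw [rlOrder]
  push_cast
  linarith

theorem hasDerivAt_integral_Ioi {f : ℝ → ℂ} (hf : Continuous f) (hi : Integrable f) (x : ℝ) :
    HasDerivAt (fun x => ∫ s in Ioi x, f s) (-f x) x := by
  have h : (fun x => ∫ s in Ioi x, f s) = fun x => (∫ s in Ioi 0, f s) - ∫ s in (0 : ℝ)..x, f s := by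
    ext y
    rw [← intervalIntegral.integral_Ioi_sub_Ioi' hi.integrableOn hi.integrableOn]
    ring
  rw [h]
  exact (intervalIntegral.integral_hasDerivAt_right (hf.intervalIntegrable _ _)
    (hf.stronglyMeasurableAtFilter _ _) hf.continuousAt).const_sub _

/-- Here the fractional integral has order `2 - α < 1`, so its symbol is locally integrable and two
derivatives pass under the Fourier integral. -/
theorem right_derivative_of_fourier_of_lt_two {α : ℝ} (h₁ : 1 < α) (h₂ : α < 2) {u g : ℝ → ℂ}
    (hu : Integrable u) (hg : Continuous g) {M : ℝ} (hM : ∀ ξ, ‖g ξ‖ ≤ M)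
    (hw : Integrable fun ξ => |ξ| ^ (α + 2) * ‖g ξ‖) (hgi : Integrable g)
    (hug : u =ᵐ[volume] 𝓕 g) :
    (∀ k < rlOrder α, Differentiable ℝ (iteratedDeriv k (rightFracIntegral (rlOrder α - α) u))) ∧
    ∀ x, rightRL α u x = 𝓕 (fun ξ => fracSymbol α ξ * g ξ) x := by
  have hint : ∀ k ≤ 2, Integrable fun ξ : ℝ => ξ ^ k • (fracSymbol (-(2 - α)) ξ * g ξ) := by
    intro k hk
    have hk' : (k : ℝ) ≤ 2 := by exact_mod_cast hk
    have hk0 : (0 : ℝ) ≤ k := k.cast_nonneg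
    exact integrable_pow_smul_fracSymbol_mul hg k _
      (integrable_rpow_abs_mul hg hM hw (by linarith) (by linarith))
  have hF : rightFracIntegral (2 - α) u = 𝓕 fun ξ => fracSymbol (-(2 - α)) ξ * g ξ := by
    ext x
    rw [rightFracIntegral_congr_ae _ hug]
    refine rightFracIntegral_fourier (by linarith) hgi (by simpa using hint 0 (by omega)) ?_
    exact integrableOn_rpow_smul (by linarith) (by linarith) (hu.congr hug)
      (ae_of_all _ (norm_fourier_le g)) x
  simp only [rightRL]
  rw [rlOrder_of_lt_two h₁ h₂, Nat.cast_ofNat, hF]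
  refine ⟨fun k hk => differentiable_iteratedDeriv_fourier hint hk, fun x => ?_⟩
  rw [iteratedDeriv_fourier_apply hint]
  refine neg_one_pow_mul_fourier _ _ _ _ _ (fun ξ hξ => ?_) x
  have := pow_mul_fracSymbol 2 (-(2 - α)) hξ
  rw [show ((2 : ℕ) : ℝ) + -(2 - α) = α by push_cast; ring] at this
  rw [← this]
  ring

/-- At `α = 2` the order jumps to 3 and the fractional integral is the plain tail integral. Its
symbol `1/(2πiξ)` need not be integrable against `g` near 0, so the first derivative is taken by the
fundamental theorem of calculus. -/
theorem right_derivative_of_fourier_two {u g : ℝ → ℂ}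
    (hu : Integrable u) (hg : Continuous g) {M : ℝ} (hM : ∀ ξ, ‖g ξ‖ ≤ M)
    (hw : Integrable fun ξ => |ξ| ^ ((2 : ℝ) + 2) * ‖g ξ‖) (hgi : Integrable g)
    (hug : u =ᵐ[volume] 𝓕 g) :
    (∀ k < rlOrder 2, Differentiable ℝ (iteratedDeriv k (rightFracIntegral (rlOrder 2 - 2) u))) ∧
    ∀ x, rightRL 2 u x = 𝓕 (fun ξ => fracSymbol 2 ξ * g ξ) x := by
  have hint : ∀ k ≤ 2, Integrable fun ξ : ℝ => ξ ^ k • g ξ := by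
    intro k hk
    have hk' : (k : ℝ) ≤ 2 := by exact_mod_cast hk
    have hk0 : (0 : ℝ) ≤ k := k.cast_nonneg
    have := integrable_pow_smul_fracSymbol_mul hg k 0
      (integrable_rpow_abs_mul hg hM hw (by linarith) (by linarith))
    simpa [fracSymbol] using this
  have hF : ∀ x, HasDerivAt (rightFracIntegral 1 u) (-𝓕 g x) x := by
    have : rightFracIntegral 1 u = fun x => ∫ s in Ioi x, 𝓕 g s := by
      ext x
      rw [rightFracIntegral_congr_ae _ hug, rightFracIntegral]
      simp
    rw [this]
    exact hasDerivAt_integral_Ioi (continuous_fourier hgi) (hu.congr hug)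
  have hF' : deriv (rightFracIntegral 1 u) = 𝓕 fun ξ => -g ξ := by
    ext x
    rw [(hF x).deriv, Real.fourier_real_eq_integral_exp_smul,
      Real.fourier_real_eq_integral_exp_smul, ← integral_neg]
    simp
  have hint' : ∀ k ≤ 2, Integrable fun ξ : ℝ => ξ ^ k • -g ξ := fun k hk => by
    simpa using (hint k hk).neg
  simp only [rightRL]
  rw [rlOrder_two, Nat.cast_ofNat, show (3 : ℝ) - 2 = 1 by norm_num]
  refine ⟨fun k hk => ?_, fun x => ?_⟩
  · rcases k with _ | k
    · exact fun x => by simpa using (hF x).differentiableAt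
    · rw [iteratedDeriv_succ', hF']
      exact differentiable_iteratedDeriv_fourier hint' (by omega)
  · rw [iteratedDeriv_succ', hF', iteratedDeriv_fourier_apply hint']
    refine neg_one_pow_mul_fourier _ _ _ _ _ (fun ξ hξ => ?_) x
    have := pow_mul_fracSymbol 2 0 hξ
    rw [show ((2 : ℕ) : ℝ) + 0 = 2 by norm_num] at this
    rw [← this]
    simp only [fracSymbol, Complex.ofReal_zero, Complex.cpow_zero]
    ring

theorem right_derivative_of_fourier {α : ℝ} (h₁ : 1 < α) (h₂ : α ≤ 2) {u g : ℝ → ℂ}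
    (hu : Integrable u) (hg : Continuous g) {M : ℝ} (hM : ∀ ξ, ‖g ξ‖ ≤ M)
    (hw : Integrable fun ξ => |ξ| ^ (α + 2) * ‖g ξ‖) (hgi : Integrable g)
    (hug : u =ᵐ[volume] 𝓕 g) :
    RightRLExists α u ∧ ∀ x, rightRL α u x = 𝓕 (fun ξ => fracSymbol α ξ * g ξ) x := by
  have hconv : ∀ x : ℝ, IntegrableOn
      (fun s : ℝ => ((s - x) ^ ((rlOrder α : ℝ) - α - 1)) • u s) (Ioi x) :=
    integrableOn_rpow_smul rlOrder_sub_pos (rlOrder_sub_le_one (by linarith)) hu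
      (hug.mono fun s hs => hs ▸ norm_fourier_le g s)
  rcases h₂.lt_or_eq with h | rfl
  · obtain ⟨hd, he⟩ := right_derivative_of_fourier_of_lt_two h₁ h hu hg hM hw hgi hug
    exact ⟨⟨hconv, hd⟩, he⟩
  · obtain ⟨hd, he⟩ := right_derivative_of_fourier_two hu hg hM hw hgi hug
    exact ⟨⟨hconv, hd⟩, he⟩

/-! ### The shifted Grünwald operator on the Fourier side -/

theorem summable_grunwald_of_bounded {α : ℝ} (h₁ : 1 ≤ α) (h₂ : α ≤ 2) {f : ℝ → ℂ} {M : ℝ}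
    (hM : ∀ x, ‖f x‖ ≤ M) (h q x : ℝ) : Summable (rightGrunwaldTerm α h q f x) := by
  refine ((summable_abs_grunwaldWeight h₁ h₂).mul_right M).of_norm_bounded fun k => ?_
  rw [rightGrunwaldTerm, norm_smul, Real.norm_eq_abs]
  gcongr
  exact hM _

theorem measurable_grunwaldSymbol (α q h : ℝ) :
    Measurable fun ξ : ℝ => grunwaldSymbol α q (Complex.I * (2 * Real.pi * h * ξ : ℝ)) := by
  unfold grunwaldSymbol
  fun_prop

theorem integrable_grunwaldSymbol_mul {α : ℝ} (hα : 0 ≤ α) (q h : ℝ) {g : ℝ → ℂ}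
    (hg : Integrable g) : Integrable fun ξ : ℝ =>
      grunwaldSymbol α q (Complex.I * (2 * Real.pi * h * ξ : ℝ)) * g ξ :=
  hg.bdd_mul (measurable_grunwaldSymbol α q h).aestronglyMeasurable
    (ae_of_all _ fun _ => norm_grunwaldSymbol_le hα _ _)

/-- A shift by `(k - q) h` multiplies the wave by `e^{qz} e^{-kz}`. Absolute summability of the
weights lets the sum enter the integral, where it is the binomial series at `e^{-z}` on the unit
circle. -/
theorem rightGrunwald_fourier {α : ℝ} (h₁ : 1 ≤ α) (h₂ : α ≤ 2) {g : ℝ → ℂ} (hg : Integrable g)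
    (h q x : ℝ) : rightGrunwald α h q (𝓕 g) x = (1 / h ^ α) •
      𝓕 (fun ξ => grunwaldSymbol α q (Complex.I * (2 * Real.pi * h * ξ : ℝ)) * g ξ) x := by
  rw [rightGrunwald]
  congr 1
  set F : ℕ → ℝ → ℂ := fun k ξ => (grunwaldWeight α k : ℂ) *
    (Complex.exp ((-2 * Real.pi * ξ * (x + (k - q) * h) : ℝ) * Complex.I) * g ξ) with hF
  have hnorm : ∀ k ξ, ‖F k ξ‖ = |grunwaldWeight α k| * ‖g ξ‖ := fun k ξ => by
    rw [hF]
    simp only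
    rw [norm_mul, norm_mul, Complex.norm_exp_ofReal_mul_I, one_mul, Complex.norm_real,
      Real.norm_eq_abs]
  have hFi : ∀ k, Integrable (F k) := fun k => by
    refine (hg.bdd_mul (c := 1) (Continuous.aestronglyMeasurable (by fun_prop))
      (ae_of_all _ fun ξ => (Complex.norm_exp_ofReal_mul_I _).le)).const_mul _
  have hsum : Summable fun k => ∫ ξ, ‖F k ξ‖ := by
    simp only [hnorm, integral_const_mul]
    exact (summable_abs_grunwaldWeight h₁ h₂).mul_right _
  have hmain := (hasSum_integral_of_summable_integral_norm hFi hsum).tsum_eq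
  rw [Real.fourier_real_eq_integral_exp_smul]
  calc ∑' k, rightGrunwaldTerm α h q (𝓕 g) x k = ∑' k, ∫ ξ, F k ξ := by
        congr 1 with k
        rw [rightGrunwaldTerm, Real.fourier_real_eq_integral_exp_smul, Complex.real_smul,
          ← integral_const_mul]
        simp only [smul_eq_mul, hF]
    _ = ∫ ξ, ∑' k, F k ξ := hmain
    _ = _ := by
        congr 1 with ξ
        set z : ℂ := Complex.I * (2 * Real.pi * h * ξ : ℝ) with hz
        have hb := (hasSum_grunwaldWeight h₁ h₂ (z := Complex.exp (-z)) (by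
          rw [hz, show (-(Complex.I * (2 * Real.pi * h * ξ : ℝ)) : ℂ) =
            ((-(2 * Real.pi * h * ξ) : ℝ) : ℂ) * Complex.I by push_cast; ring,
            Complex.norm_exp_ofReal_mul_I])).mul_left
          (Complex.exp ((-2 * Real.pi * ξ * x : ℝ) * Complex.I) * Complex.exp (q * z) * g ξ)
        rw [smul_eq_mul, grunwaldSymbol, show Complex.exp ((-2 * Real.pi * ξ * x : ℝ) * Complex.I) *
          (Complex.exp (q * z) * (1 - Complex.exp (-z)) ^ (α : ℂ) * g ξ) =
          Complex.exp ((-2 * Real.pi * ξ * x : ℝ) * Complex.I) * Complex.exp (q * z) * g ξ *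
            (1 - Complex.exp (-z)) ^ (α : ℂ) by ring, ← hb.tsum_eq]
        congr 1 with k
        rw [hF]
        simp only
        rw [← Complex.exp_nat_mul, show (((-2 * Real.pi * ξ * (x + (k - q) * h) : ℝ) : ℂ) *
          Complex.I) = ((-2 * Real.pi * ξ * x : ℝ) : ℂ) * Complex.I + q * z + k * -z by
            rw [hz]; push_cast; ring, Complex.exp_add, Complex.exp_add]
        ring

theorem fracSymbol_eq_of_scale {α h : ℝ} (hα : α ≠ 0) (hh : 0 < h) (ξ : ℝ) :
    (1 / h ^ α) • (Complex.I * (2 * Real.pi * h * ξ : ℝ)) ^ (α : ℂ) = fracSymbol α ξ := by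
  have hα' : (α : ℂ) ≠ 0 := by exact_mod_cast hα
  have h1 : (Complex.I * (2 * Real.pi * h * ξ : ℝ) : ℂ) = (2 * Real.pi * Complex.I * ξ) * h := by
    push_cast; ring
  have hpos : 0 < h ^ α := Real.rpow_pos_of_pos hh _
  have hne : ((h ^ α : ℝ) : ℂ) ≠ 0 := by exact_mod_cast hpos.ne'
  rw [h1, mul_cpow_of_re_nonneg_of_re_pos (by simp) (by simpa using hh) hα', fracSymbol,
    ← Complex.ofReal_cpow hh.le, Complex.real_smul, Complex.ofReal_div, Complex.ofReal_one]
  field_simp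

theorem rightWSGD_sub_fourier {α : ℝ} (h₁ : 1 ≤ α) (h₂ : α ≤ 2) {g : ℝ → ℂ} (hg : Integrable g)
    (hgα : Integrable fun ξ => fracSymbol α ξ * g ξ) {h : ℝ} (hh : 0 < h) {m : ℕ}
    (q γ : Fin m → ℝ) (x : ℝ) :
    rightWSGD α h q γ (𝓕 g) x - 𝓕 (fun ξ => fracSymbol α ξ * g ξ) x =
      𝓕 (fun ξ => (1 / h ^ α) • (∑ j, (γ j : ℂ) *
        grunwaldSymbol α (q j) (Complex.I * (2 * Real.pi * h * ξ : ℝ)) -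
        (Complex.I * (2 * Real.pi * h * ξ : ℝ)) ^ (α : ℂ)) * g ξ) x := by
  have hexp : ∀ {f : ℝ → ℂ}, Integrable f →
      Integrable fun ξ : ℝ => Complex.exp ((-2 * Real.pi * ξ * x : ℝ) * Complex.I) * f ξ :=
    fun hf => hf.bdd_mul (c := 1) (Continuous.aestronglyMeasurable (by fun_prop))
      (ae_of_all _ fun ξ => (Complex.norm_exp_ofReal_mul_I _).le)
  simp only [rightWSGD, rightGrunwald_fourier h₁ h₂ hg, Real.fourier_real_eq_integral_exp_smul,
    smul_eq_mul, ← integral_smul]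
  have hterm : ∀ j ∈ Finset.univ, Integrable fun ξ : ℝ => γ j • (1 / h ^ α) •
      (Complex.exp ((-2 * Real.pi * ξ * x : ℝ) * Complex.I) *
        (grunwaldSymbol α (q j) (Complex.I * (2 * Real.pi * h * ξ : ℝ)) * g ξ)) := fun j _ =>
    ((hexp (integrable_grunwaldSymbol_mul (by linarith) (q j) h hg)).smul (1 / h ^ α)).smul (γ j)
  rw [← integral_finsetSum _ hterm, ← integral_sub (integrable_finsetSum _ hterm) (hexp hgα)]
  congr 1 with ξ
  rw [smul_sub, fracSymbol_eq_of_scale (by linarith) hh]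
  simp only [Complex.real_smul, sub_mul, mul_sub, Finset.mul_sum, Finset.sum_mul]
  congr 1
  exact Finset.sum_congr rfl fun j _ => by ring

theorem exists_rightWSGD_bound {α : ℝ} (h₁ : 1 ≤ α) (h₂ : α ≤ 2) {g : ℝ → ℂ} (hg : Integrable g)
    (hgα : Integrable fun ξ => fracSymbol α ξ * g ξ)
    (hw : Integrable fun ξ => |ξ| ^ (α + 2) * ‖g ξ‖) {m : ℕ} (q γ : Fin m → ℝ)
    (hγ : ∑ j, γ j = 1) (hγq : ∑ j, γ j * (q j - α / 2) = 0) :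
    ∃ C : ℝ, ∀ h : ℝ, 0 < h → ∀ x,
      ‖rightWSGD α h q γ (𝓕 g) x - 𝓕 (fun ξ => fracSymbol α ξ * g ξ) x‖ ≤ C * h ^ 2 := by
  obtain ⟨C, hC, hb⟩ := exists_symbol_bound (by linarith) q γ hγ hγq
  -- The symbol bound is used at `y = 2πhξ`; then `h^{-α} h^{α+2} = h²`.
  refine ⟨∫ ξ, C * (2 * Real.pi) ^ (α + 2) * (|ξ| ^ (α + 2) * ‖g ξ‖), fun h hh x => ?_⟩
  rw [rightWSGD_sub_fourier h₁ h₂ hg hgα hh, ← integral_mul_const]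
  refine (norm_fourier_le _ x).trans (integral_mono_of_nonneg (ae_of_all _ fun _ => norm_nonneg _)
    ((hw.const_mul _).mul_const _) (ae_of_all _ fun ξ => ?_))
  have hpos : 0 < h ^ α := Real.rpow_pos_of_pos hh _
  have h3 : |2 * Real.pi * h * ξ| ^ (α + 2) = (2 * Real.pi) ^ (α + 2) * (h ^ α * h ^ 2) *
      |ξ| ^ (α + 2) := by
    rw [abs_mul, abs_mul, abs_of_pos Real.two_pi_pos, abs_of_pos hh,
      Real.mul_rpow (by positivity) (abs_nonneg _), Real.mul_rpow (by positivity) hh.le,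
      Real.rpow_add hh]
    norm_num
  simp only
  rw [norm_mul, norm_smul, Real.norm_of_nonneg (by positivity)]
  calc _ ≤ 1 / h ^ α * (C * |2 * Real.pi * h * ξ| ^ (α + 2)) * ‖g ξ‖ := by
        gcongr
        exact hb _
    _ = _ := by
        rw [h3]
        field_simp

theorem rightGrunwaldTerm_congr {u f : ℝ → ℂ} {α h q x : ℝ}
    (hx : ∀ k : ℕ, u (x + ((k : ℝ) - q) * h) = f (x + ((k : ℝ) - q) * h)) :
    rightGrunwaldTerm α h q u x = rightGrunwaldTerm α h q f x := by
  ext k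
  rw [rightGrunwaldTerm, rightGrunwaldTerm, hx]

end WSGD

end


theorem theorem2 (α : ℝ) (hα₁ : 1 < α) (hα₂ : α ≤ 2)
    (u : ℝ → ℂ) (hu : MeasureTheory.Integrable u)
    (hD : WSGD.LeftRLExists (α + 2) u)
    (hD_int : MeasureTheory.Integrable (WSGD.leftRL (α + 2) u))
    (hD_fourier : MeasureTheory.Integrable (𝓕 (WSGD.leftRL (α + 2) u)))
    (m : ℕ) (hm : 2 ≤ m) (q γ : Fin m → ℝ)
    (hγ : ∑ j, γ j = 1) (hγq : ∑ j, γ j * (q j - α / 2) = 0) :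
    WSGD.RightRLExists α u ∧
    ∃ C : ℝ, ∀ h : ℝ, 0 < h →
      (∀ᵐ x : ℝ, (∀ j, Summable (WSGD.rightGrunwaldTerm α h (q j) u x)) ∧
        ‖WSGD.rightWSGD α h q γ u x - WSGD.rightRL α u x‖ ≤ C * h ^ 2) ∧
      (Continuous u → ∀ x : ℝ, (∀ j, Summable (WSGD.rightGrunwaldTerm α h (q j) u x)) ∧
        ‖WSGD.rightWSGD α h q γ u x - WSGD.rightRL α u x‖ ≤ C * h ^ 2) := by
  open MeasureTheory WSGD in
  have hn : 2 ≤ rlOrder (α + 2) := by rw [rlOrder_add_two (by linarith)]; omega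
  have hsymb := fourier_iteratedDeriv_leftFracIntegral rlOrder_sub_pos
    (rlOrder_sub_le_one (by linarith)) hn hu hD.2 hD_int
  rw [sub_sub_cancel] at hsymb
  have hw' : Integrable fun ξ => |ξ| ^ (α + 2) * ‖𝓕 u ξ‖ :=
    integrable_rpow_abs_mul_of_fracSymbol (hD_fourier.congr hsymb)
  -- The weight is even, and `𝓕⁻ u` is the reflection of `𝓕 u`.
  have hw : Integrable fun ξ => |ξ| ^ (α + 2) * ‖𝓕⁻ u ξ‖ := by
    simpa [Real.fourierInv_eq_fourier_neg] using hw'.comp_neg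
  have hg : Continuous (𝓕⁻ u) := by
    have : 𝓕⁻ u = fun ξ => 𝓕 u (-ξ) := funext (Real.fourierInv_eq_fourier_neg u)
    rw [this]
    exact (continuous_fourier hu).comp continuous_neg
  have hM : ∀ ξ, ‖𝓕⁻ u ξ‖ ≤ ∫ y, ‖u y‖ := fun ξ => by
    rw [Real.fourierInv_eq_fourier_neg]
    exact norm_fourier_le u _
  have hgi : Integrable (𝓕⁻ u) := by
    have := integrable_rpow_abs_mul hg hM hw (s := 0) (by norm_num) (by linarith)
    refine (integrable_norm_iff hg.aestronglyMeasurable).1 ?_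
    simpa using this
  have hug := (fourier_fourierInv_ae_eq hu hgi).symm
  have hgα := integrable_fracSymbol_mul hg α
    (integrable_rpow_abs_mul hg hM hw (by linarith) (by linarith))
  obtain ⟨hex, hRL⟩ := right_derivative_of_fourier hα₁ hα₂ hu hg hM hw hgi hug
  obtain ⟨C, hC⟩ := exists_rightWSGD_bound hα₁.le hα₂ hgi hgα hw q γ hγ hγq
  -- The operator sees `u` only on the grid points of `x`, so agreement with `𝓕 (𝓕⁻ u)` there is
  -- enough; the right derivative is insensitive to null sets.
  have key : ∀ h, 0 < h → ∀ x, (∀ (j : Fin m) (k : ℕ),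
      u (x + ((k : ℝ) - q j) * h) = 𝓕 (𝓕⁻ u) (x + ((k : ℝ) - q j) * h)) →
      (∀ j, Summable (rightGrunwaldTerm α h (q j) u x)) ∧
        ‖rightWSGD α h q γ u x - rightRL α u x‖ ≤ C * h ^ 2 := by
    intro h hh x hx
    have hterm := fun j => rightGrunwaldTerm_congr (α := α) (hx j)
    refine ⟨fun j => hterm j ▸ summable_grunwald_of_bounded hα₁.le hα₂ (norm_fourier_le _) _ _ _, ?_⟩
    have : rightWSGD α h q γ u x = rightWSGD α h q γ (𝓕 (𝓕⁻ u)) x := by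
      simp only [rightWSGD, rightGrunwald, hterm]
    rw [this, hRL]
    exact hC h hh x
  refine ⟨hex, C, fun h hh => ⟨?_, fun hcu x => key h hh x fun j k => ?_⟩⟩
  -- The bad `x` lie in countably many translates of one null set.
  · have hshift : ∀ᵐ x : ℝ, ∀ (j : Fin m) (k : ℕ),
        u (x + ((k : ℝ) - q j) * h) = 𝓕 (𝓕⁻ u) (x + ((k : ℝ) - q j) * h) :=
      ae_all_iff.2 fun j => ae_all_iff.2 fun k =>
        (measurePreserving_add_right volume _).quasiMeasurePreserving.ae hug
    exact hshift.mono fun x hx => key h hh x hx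
  · exact congrFun ((Continuous.ae_eq_iff_eq volume hcu (continuous_fourier hgi)).1 hug) _
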